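/- Let $X=(X_t)_{t\ge 0}$ be a spectrally negative L\'evy process, i.e. a real-valued c\`adl\`ag process with $X_0=0$ and stationary independent increments, whose law is given by $E(e^{i\theta X_t})=e^{-t\Psi(\theta)}$, $\theta\in\mathbb R$, $$\Psi(\theta)=i\mu\theta+\tfrac{\sigma^2}{2}\theta^2+\int_{\mathbb R\setminus\{0\}}\bigl(1-e^{i\theta x}+i\theta x\mathbf 1_{|x|<1}\bigr)\,\Pi(dx),$$ with $\mu,\sigma\in\mathbb R$ and a measure $\Pi$ on $\mathbb R\setminus\{0\}$ satisfying $\int(1\wedge x^2)\,\Pi(dx)<\infty$ and $\Pi(0,\infty)=0$; the case in which $X$ has monotone paths almost surely is excluded. Let $\psi$ be its Laplace exponent, $E(e^{\lambda X_t})=e^{\psi(\lambda)t}$ for $\lambda\ge 0$, and for $q\ge 0$ let $\Phi(q)=\sup\{\lambda\ge 0:\psi(\lambda)=q\}$. Let $W^{(q)}:\mathbb R\to[0,\infty)$ be the $q$-scale function, i.e. $W^{(q)}(x)=0$ for $x<0$, and on $[0,\infty)$ it is the unique right-continuous function with $$\int_0^\infty e^{-\beta x}W^{(q)}(x)\,dx=\frac{1}{\psi(\beta)-q},\qquad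 \beta>\Phi(q).$$ Write $\overline\Pi(x)=\Pi(-\infty,-x)$ for $x>0$, and suppose that $-\overline\Pi$ has a density on $(0,\infty)$ which is completely monotone: $\overline\Pi(x)=\int_x^\infty \pi(y)\,dy$ for all $x>0$, where $\pi$ is infinitely differentiable on $(0,\infty)$ and $(-1)^n\pi^{(n)}\ge 0$ there for all $n\ge 0$. Let $q>0$, or let $q=0$ and $\Phi(0)>0$. Then $W^{(q)}$ is differentiable on $(0,\infty)$ and its derivative is strictly convex on $(0,\infty)$. In particular there is a constant $a^*\in[0,\infty)$ such that $W^{(q)}$ is strictly concave on $(0,a^*)$ and strictly convex on $(a^*,\infty)$. -/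

import Mathlib

open Set Filter Topology MeasureTheory ProbabilityTheory
open scoped NNReal ENNReal

/-- A real-valued Lévy process on `(Ω, P)`: it starts from `0`, has stationary and independent
increments, and almost surely has paths that are right-continuous with left limits. -/
structure IsLevyProcess {Ω : Type*} [MeasurableSpace Ω] (X : ℝ≥0 → Ω → ℝ) (P : Measure Ω) :
    Prop where
  measurable : ∀ t, Measurable (X t)
  start : ∀ᵐ ω ∂P, X 0 ω = 0
  indep : HasIndepIncrements X P
  stationary : ∀ s t : ℝ≥0, IdentDistrib (fun ω => X (s + t) ω - X s ω) (X t) P P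
  cadlag : ∀ᵐ ω ∂P, ∀ t : ℝ≥0, ContinuousWithinAt (fun s => X s ω) (Ici t) t ∧
    ∃ l : ℝ, Tendsto (fun s => X s ω) (𝓝[<] t) (𝓝 l)

/-- `ν` is a measure carried by `ℝ ∖ {0}` that integrates `1 ∧ x²`. -/
structure IsLevyMeasure (ν : Measure ℝ) : Prop where
  zero : ν {0} = 0
  lintegral_lt_top : ∫⁻ x, ENNReal.ofReal (min 1 (x ^ 2)) ∂ν < ∞

/-- The characteristic exponent
`Ψ(θ) = i μ θ + σ² θ² / 2 + ∫ (1 - e^{iθx} + i θ x 1_{|x| < 1}) ν(dx)`. -/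
noncomputable def levyKhintchineExponent (μ σ : ℝ) (ν : Measure ℝ) (θ : ℝ) : ℂ :=
  Complex.I * μ * θ + (σ : ℂ) ^ 2 / 2 * (θ : ℂ) ^ 2 +
    ∫ x : ℝ, (1 - Complex.exp (Complex.I * θ * x) +
      (if |x| < 1 then Complex.I * θ * x else 0)) ∂ν

/-- The Lévy process `X` has Lévy–Khintchine triplet `(μ, σ, ν)`; in particular `ν` is its
Lévy measure: `E e^{iθ X_t} = e^{-t Ψ(θ)}`. -/
structure HasLevyTriplet {Ω : Type*} [MeasurableSpace Ω] (X : ℝ≥0 → Ω → ℝ) (P : Measure Ω)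
    (μ σ : ℝ) (ν : Measure ℝ) : Prop where
  isLevyMeasure : IsLevyMeasure ν
  charFun_eq : ∀ (t : ℝ≥0) (θ : ℝ), charFun (P.map (X t)) θ =
    Complex.exp (-((t : ℝ) : ℂ) * levyKhintchineExponent μ σ ν θ)

/-- A spectrally negative Lévy process with triplet `(μ, σ, ν)`: a Lévy process whose Lévy measure
does not charge `(0, ∞)`, the case of (almost surely) monotone paths being excluded. -/
structure IsSpectrallyNegativeLevy {Ω : Type*} [MeasurableSpace Ω] (X : ℝ≥0 → Ω → ℝ)
    (P : Measure Ω) (μ σ : ℝ) (ν : Measure ℝ) : Prop where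
  isLevy : IsLevyProcess X P
  triplet : HasLevyTriplet X P μ σ ν
  no_pos_jumps : ν (Ioi 0) = 0
  not_monotone : ¬ ∀ᵐ ω ∂P, Monotone (fun t => X t ω)
  not_antitone : ¬ ∀ᵐ ω ∂P, Antitone (fun t => X t ω)

/-- The Laplace exponent `ψ(l) = log E e^{l X_1}`. -/
noncomputable def laplaceExponent {Ω : Type*} [MeasurableSpace Ω] (X : ℝ≥0 → Ω → ℝ)
    (P : Measure Ω) (l : ℝ) : ℝ :=
  cgf (X 1) P l

/-- `Φ(q) = sup {l ≥ 0 : ψ(l) = q}`, for a function `ψ`. -/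
noncomputable def largestRoot (ψ : ℝ → ℝ) (q : ℝ) : ℝ :=
  sSup {l : ℝ | 0 ≤ l ∧ ψ l = q}

/-- `W` is the `q`-scale function attached to the Laplace exponent `ψ`: it takes values in `[0, ∞)`,
vanishes on `(-∞, 0)`, is right-continuous on `[0, ∞)`, and its Laplace transform at every
`β > Φ(q)` is (finite and) equal to `1 / (ψ(β) - q)`. -/
structure IsScaleFunction (ψ : ℝ → ℝ) (q : ℝ) (W : ℝ → ℝ) : Prop where
  nonneg : ∀ x, 0 ≤ W x
  eq_zero : ∀ x < 0, W x = 0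
  rightCont : ∀ x, 0 ≤ x → ContinuousWithinAt W (Ici x) x
  integrable : ∀ β, largestRoot ψ q < β →
    IntegrableOn (fun x => Real.exp (-β * x) * W x) (Ioi 0)
  laplace : ∀ β, largestRoot ψ q < β →
    ∫ x in Ioi (0 : ℝ), Real.exp (-β * x) * W x = 1 / (ψ β - q)

/-- `f` is completely monotone on `(0, ∞)`. -/
def IsCompletelyMonotone (f : ℝ → ℝ) : Prop :=
  ContDiffOn ℝ ((⊤ : ℕ∞) : WithTop ℕ∞) f (Ioi 0) ∧ ∀ (n : ℕ) (x : ℝ), 0 < x → 0 ≤ (-1) ^ n * iteratedDeriv n f x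

/-- The function `-Π̄`, where `Π̄(x) = ν(-∞, -x)` for `x > 0`, has a completely monotone density
`f` on `(0, ∞)`, i.e. `Π̄(x) = ∫_x^∞ f(y) dy` for all `x > 0`. -/
def HasCompletelyMonotoneTailDensity (ν : Measure ℝ) : Prop :=
  ∃ f : ℝ → ℝ, IsCompletelyMonotone f ∧
    ∀ x : ℝ, 0 < x → ν (Iio (-x)) = ∫⁻ y in Ioi x, ENNReal.ofReal (f y)

/-! The scale function is shown to be W(x) = A e^{Φx} - ∫ e^{-xs} m(ds) on (0, ∞), with A > 0, Φ =
Φ(q) > 0 and m a finite measure on [0, ∞). Then W''' > 0 term by term, so W' is strictly convex; W''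
is strictly increasing and eventually positive, and a* is the point where it becomes nonnegative.

The representation comes from Stieltjes functions, the mixtures of 1 and of 1/(b + s), s ≥ 0. By
Bernstein's theorem the jump density is a mixture of exponentials. Integrating the divided
difference of the Lévy–Khintchine integrand then gives ψ(b) = b (ψ(1) + (b - 1) R(b)) with R
Stieltjes (`IsLevyMeasure.exists_levyLaplaceExponent_eq`). Dividing out the root Φ gives ψ(b) - q =
(b - Φ) b S(b) with S again Stieltjes, nonzero because ψ is not constant. The key closure property
is that T(b) = 1/(b S(b)) is also Stieltjes (`IsStieltjes.inv_mul`): for discrete S it is the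
spectral theorem for a rank one perturbation of a diagonal matrix, and the general case follows by
weak compactness. Partial fractions applied to T(b)/(b - Φ) give 1/(ψ(b) - q) = A/(b - Φ) - ∫
m(ds)/(b + s) (`exists_inv_sub_eq`), and uniqueness of Laplace transforms identifies W.

The probabilistic input is that the Laplace exponent of the process is the Lévy–Khintchine
expression at nonnegative real arguments, obtained from compound Poisson approximation, and that it
is unbounded above because the paths are not almost surely decreasing. -/

/-! ### Weak compactness and Stieltjes functions -/

/-- Finite measures of mass at most `C` on a compact space form a weakly compact set, so the
sequence has a limit along a free ultrafilter. That ultrafilter refines `atTop`, hence every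
integral that already converges has its limit computed by the one measure `κ₀`. -/
theorem exists_integral_eq_of_tendsto {E : Type*} [MeasurableSpace E]
    [TopologicalSpace E] [T2Space E] [BorelSpace E] [CompactSpace E]
    (κ : ℕ → Measure E) (hκ : ∀ n, IsFiniteMeasure (κ n)) (C : ℝ≥0) (hC : ∀ n, κ n univ ≤ C) :
    ∃ κ₀ : Measure E, IsFiniteMeasure κ₀ ∧ ∀ h : E → ℝ, Continuous h → ∀ l : ℝ,
      Tendsto (fun n => ∫ x, h x ∂(κ n)) atTop (𝓝 l) → ∫ x, h x ∂κ₀ = l := by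
  let κ' : ℕ → FiniteMeasure E := fun n => ⟨κ n, hκ n⟩
  obtain ⟨κ₀, -, hκ₀⟩ := (isCompact_setOfPred_finiteMeasure_le_of_compactSpace E C).ultrafilter_le_nhds
    ((hyperfilter ℕ).map κ') (by
      rw [le_principal_iff, Ultrafilter.coe_map, mem_map]
      refine Eventually.of_forall fun n => ?_
      change (κ' n).mass ≤ C
      rw [← ENNReal.coe_le_coe, FiniteMeasure.ennreal_mass]
      exact hC n)
  refine ⟨κ₀, inferInstance, fun h hh l hl => ?_⟩
  have h1 : Tendsto κ' (hyperfilter ℕ : Filter ℕ) (𝓝 κ₀) := hκ₀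
  have h2 := (FiniteMeasure.tendsto_iff_forall_integral_tendsto.1 h1)
    (BoundedContinuousFunction.mkOfCompact ⟨h, hh⟩)
  have h3 : (hyperfilter ℕ : Filter ℕ) ≤ atTop := by
    rw [← Nat.cofinite_eq_atTop]; exact hyperfilter_le_cofinite
  exact tendsto_nhds_unique h2 (hl.mono_left h3)

/-- The kernel `u ↦ 1 / (1 + (b - 1) u)` on `[0, 1]`; with `u = 1 / (1 + s)` it is
`(1 + s) / (b + s)`. -/
noncomputable def cauchyKernel (b : ℝ) (u : unitInterval) : ℝ := (1 + (b - 1) * (u : ℝ))⁻¹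

theorem cauchyKernel_denom_pos {b : ℝ} (hb : 0 < b) (u : unitInterval) :
    0 < 1 + (b - 1) * (u : ℝ) := by
  have h0 := u.2.1
  have h1 := u.2.2
  rcases eq_or_lt_of_le h0 with h | h
  · rw [← h]; norm_num
  · nlinarith [mul_pos hb h]

theorem cauchyKernel_pos {b : ℝ} (hb : 0 < b) (u : unitInterval) : 0 < cauchyKernel b u :=
  inv_pos.2 (cauchyKernel_denom_pos hb u)

theorem continuous_cauchyKernel {b : ℝ} (hb : 0 < b) : Continuous (cauchyKernel b) :=
  Continuous.inv₀ (by fun_prop) fun u => (cauchyKernel_denom_pos hb u).ne'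

theorem Continuous.integrable_of_compactSpace {E : Type*} [TopologicalSpace E] [CompactSpace E]
    [MeasurableSpace E] [BorelSpace E] {f : E → ℝ} (hf : Continuous f)
    (κ : Measure E) [IsFiniteMeasure κ] : Integrable f κ :=
  (BoundedContinuousFunction.mkOfCompact ⟨f, hf⟩).integrable κ

/-- Stieltjes functions on `(0, ∞)`, i.e. mixtures of a constant and the functions
`b ↦ 1 / (b + s)`, `s ≥ 0`. -/
def IsStieltjes (F : ℝ → ℝ) : Prop :=
  ∃ κ : Measure unitInterval, IsFiniteMeasure κ ∧ ∀ b, 0 < b → F b = ∫ u, cauchyKernel b u ∂κ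

namespace IsStieltjes

theorem congr {F G : ℝ → ℝ} (hF : IsStieltjes F) (h : ∀ b, 0 < b → G b = F b) :
    IsStieltjes G := by
  obtain ⟨κ, h1, h2⟩ := hF
  exact ⟨κ, h1, fun b hb => (h b hb).trans (h2 b hb)⟩

theorem integrable_cauchyKernel {b : ℝ} (hb : 0 < b) (κ : Measure unitInterval)
    [IsFiniteMeasure κ] : Integrable (_root_.cauchyKernel b) κ :=
  (continuous_cauchyKernel hb).integrable_of_compactSpace κ

/-- The point b = 1 is left out because divided differences between 1 and b take a junk value there.
Masses are therefore controlled at b = 2, where the kernel is at least 1/2. -/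
theorem exists_of_tendsto {F : ℕ → ℝ → ℝ} {G : ℝ → ℝ} (hF : ∀ n, IsStieltjes (F n))
    (h : ∀ b, 0 < b → b ≠ 1 → Tendsto (fun n => F n b) atTop (𝓝 (G b))) :
    ∃ G', IsStieltjes G' ∧ ∀ b, 0 < b → b ≠ 1 → G' b = G b := by
  choose κ hκ hF using hF
  have hmass : ∀ n, (κ n).real univ ≤ 2 * F n 2 := by
    intro n
    rw [hF n 2 two_pos, ← integral_const_mul]
    have h1 : (κ n).real univ = ∫ _, (1 : ℝ) ∂(κ n) := by simp
    rw [h1]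
    refine integral_mono (integrable_const _) ((integrable_cauchyKernel two_pos _).const_mul 2)
      fun u => ?_
    have h2 := cauchyKernel_denom_pos two_pos u
    simp only [cauchyKernel]
    rw [← div_eq_mul_inv, le_div_iff₀ h2]
    linarith [u.2.2]
  obtain ⟨C, hC⟩ := (h 2 two_pos (by norm_num)).bddAbove_range
  obtain ⟨κ₀, hfin, hκ₀⟩ := exists_integral_eq_of_tendsto κ hκ (2 * C).toNNReal (fun n => by
      rw [← ofReal_measureReal]
      exact ENNReal.ofReal_le_ofReal ((hmass n).trans (by linarith [hC ⟨n, rfl⟩])))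
  exact ⟨fun b => ∫ u, cauchyKernel b u ∂κ₀, ⟨κ₀, hfin, fun b _ => rfl⟩, fun b hb hb1 =>
    hκ₀ _ (continuous_cauchyKernel hb) _ ((h b hb hb1).congr fun n => hF n b hb)⟩

/-- The kernel is identically 1 at b = 1, so the mass of the representing measure is F(1). -/
theorem of_tendsto {F : ℕ → ℝ → ℝ} {G : ℝ → ℝ} (hF : ∀ n, IsStieltjes (F n))
    (h : ∀ b, 0 < b → Tendsto (fun n => F n b) atTop (𝓝 (G b))) : IsStieltjes G := by
  choose κ hκ hF using hF
  have hmass : ∀ n, (κ n).real univ = F n 1 := by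
    intro n
    rw [hF n 1 one_pos]
    simp [cauchyKernel]
  obtain ⟨C, hC⟩ := (h 1 one_pos).bddAbove_range
  obtain ⟨κ₀, hfin, hκ₀⟩ := exists_integral_eq_of_tendsto κ hκ C.toNNReal (fun n => by
      rw [← ofReal_measureReal, hmass]
      exact ENNReal.ofReal_le_ofReal (hC ⟨n, rfl⟩))
  exact ⟨κ₀, hfin, fun b hb =>
    (hκ₀ _ (continuous_cauchyKernel hb) _ ((h b hb).congr fun n => hF n b hb)).symm⟩

theorem zero : IsStieltjes fun _ => 0 := ⟨0, inferInstance, fun b _ => by simp⟩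

theorem add {F G : ℝ → ℝ} (hF : IsStieltjes F) (hG : IsStieltjes G) :
    IsStieltjes fun b => F b + G b := by
  obtain ⟨κ, h1, h2⟩ := hF
  obtain ⟨κ', h1', h2'⟩ := hG
  refine ⟨κ + κ', inferInstance, fun b hb => ?_⟩
  simp only
  rw [integral_add_measure ((continuous_cauchyKernel hb).integrable_of_compactSpace κ)
    ((continuous_cauchyKernel hb).integrable_of_compactSpace κ'), h2 b hb, h2' b hb]

theorem const_mul {F : ℝ → ℝ} (hF : IsStieltjes F) {c : ℝ} (hc : 0 ≤ c) :
    IsStieltjes fun b => c * F b := by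
  obtain ⟨κ, h1, h2⟩ := hF
  refine ⟨c.toNNReal • κ, inferInstance, fun b hb => ?_⟩
  simp only
  rw [h2 b hb, integral_smul_nnreal_measure, NNReal.smul_def, Real.coe_toNNReal c hc, smul_eq_mul]

theorem sum {ι : Type*} (s : Finset ι) {F : ι → ℝ → ℝ} (hF : ∀ i ∈ s, IsStieltjes (F i)) :
    IsStieltjes fun b => ∑ i ∈ s, F i b := by
  classical
  induction s using Finset.induction_on with
  | empty => simpa using zero
  | insert i s hi ih =>
    simp_rw [Finset.sum_insert hi]
    exact (hF i (by simp)).add (ih fun j hj => hF j (by simp [hj]))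

theorem cauchyKernel (u : unitInterval) : IsStieltjes fun b => cauchyKernel b u :=
  ⟨Measure.dirac u, inferInstance, fun b hb => by
    rw [integral_dirac]⟩

theorem const {c : ℝ} (hc : 0 ≤ c) : IsStieltjes fun _ => c :=
  ((cauchyKernel 0).const_mul hc).congr fun b _ => by simp [_root_.cauchyKernel]

theorem inv_add {t : ℝ} (ht : 0 ≤ t) : IsStieltjes fun b => (t + b)⁻¹ := by
  have h1 : 0 < 1 + t := by linarith
  have h2 : (1 + t)⁻¹ ≤ 1 := inv_le_one_of_one_le₀ (by linarith)
  refine ((cauchyKernel ⟨(1 + t)⁻¹, by positivity, h2⟩).const_mul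
    (inv_nonneg.2 h1.le)).congr fun b hb => ?_
  have : t + b ≠ 0 := by positivity
  simp only [_root_.cauchyKernel]
  rw [← mul_inv, mul_add, mul_one]
  congr 1
  field_simp
  ring

end IsStieltjes

/-! ### Reciprocals of Stieltjes functions -/

/-- Resolvent of a rank one perturbation of a diagonal matrix. -/
theorem exists_inv_sub_sum_eq {ι : Type*} [Fintype ι] (r s : ι → ℝ) (a : ℝ) (ha : 0 < a)
    (hr : ∀ i, 0 ≤ r i) (hs : ∀ i, 0 < s i) (hsum : ∑ i, r i / s i ≤ a) :
    ∃ t w : Fin (Fintype.card ι) → ℝ, (∀ j, 0 ≤ t j) ∧ (∀ j, 0 ≤ w j) ∧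
      ∀ b, 0 < b → (a - ∑ i, r i / (s i + b)) ≠ 0 →
        (a - ∑ i, r i / (s i + b))⁻¹ = a⁻¹ + ∑ j, w j * (t j + b)⁻¹ := by
  classical
  let v : EuclideanSpace ℝ ι := WithLp.toLp 2 fun i => √(r i)
  let D : EuclideanSpace ℝ ι →ₗ[ℝ] EuclideanSpace ℝ ι :=
    { toFun := fun x => WithLp.toLp 2 fun i => s i * x i
      map_add' := fun x y => by ext i; simp [mul_add]
      map_smul' := fun c x => by ext i; simp; ring }
  have hD : ∀ x i, D x i = s i * x i := fun x i => rfl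
  have hinner : ∀ x y : EuclideanSpace ℝ ι, inner ℝ x y = ∑ i, x i * y i := fun x y => by
    simp [PiLp.inner_apply, mul_comm]
  -- T = D - a⁻¹ v vᵀ with D = diag(s) and v = (√r i). The `t j` will be its eigenvalues, and the
  -- weights come from the coordinates of v in its eigenbasis.
  let T : EuclideanSpace ℝ ι →ₗ[ℝ] EuclideanSpace ℝ ι := D - a⁻¹ • (LinearMap.toSpanSingleton ℝ (EuclideanSpace ℝ ι) v).comp (innerₗ (EuclideanSpace ℝ ι) v)
  have hT : ∀ x, T x = D x - (a⁻¹ * inner ℝ v x) • v := fun x => by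
    simp [T, mul_smul]
  have hTs : T.IsSymmetric := by
    intro x y
    rw [hT, hT, inner_sub_left, inner_sub_right, inner_smul_left, inner_smul_right]
    have : inner ℝ (D x) y = inner ℝ x (D y) := by
      rw [hinner, hinner]
      exact Finset.sum_congr rfl fun i _ => by rw [hD, hD]; ring
    rw [this, real_inner_comm v x]
    simp only [conj_trivial]
    ring
  have hfr : Module.finrank ℝ (EuclideanSpace ℝ ι) = Fintype.card ι := by simp
  let e := hTs.eigenvectorBasis hfr
  let t := hTs.eigenvalues hfr
  -- Cauchy–Schwarz weighted by `s i` gives ⟨x, v⟩² ≤ (∑ r i / s i) ⟨x, Dx⟩ ≤ a ⟨x, Dx⟩, so T is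
  -- positive semidefinite.
  have hpos : ∀ x : EuclideanSpace ℝ ι, 0 ≤ inner ℝ x (T x) := by
    intro x
    rw [hT, inner_sub_right, inner_smul_right, real_inner_comm v x, sub_nonneg]
    have hcs : (inner ℝ x v) ^ 2 ≤ (∑ i, r i / s i) * ∑ i, s i * x i ^ 2 := by
      rw [hinner]
      refine (Finset.sum_mul_sq_le_sq_mul_sq Finset.univ
        (fun i => √(r i / s i)) (fun i => √(s i) * x i)).trans' (le_of_eq ?_) |>.trans (le_of_eq ?_)
      · congr 1
        refine Finset.sum_congr rfl fun i _ => ?_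
        rw [← mul_assoc, ← Real.sqrt_mul (div_nonneg (hr i) (hs i).le),
          div_mul_cancel₀ _ (hs i).ne', mul_comm]
      · congr 1
        · exact Finset.sum_congr rfl fun i _ => Real.sq_sqrt (div_nonneg (hr i) (hs i).le)
        · exact Finset.sum_congr rfl fun i _ => by rw [mul_pow, Real.sq_sqrt (hs i).le]
    have hnn : 0 ≤ ∑ i, s i * x i ^ 2 :=
      Finset.sum_nonneg fun i _ => mul_nonneg (hs i).le (sq_nonneg _)
    have h1 : inner ℝ x (D x) = ∑ i, s i * x i ^ 2 := by
      rw [hinner]; exact Finset.sum_congr rfl fun i _ => by rw [hD]; ring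
    rw [h1]
    have h2 : (inner ℝ x v) ^ 2 ≤ a * ∑ i, s i * x i ^ 2 :=
      hcs.trans (mul_le_mul_of_nonneg_right hsum hnn)
    rw [real_inner_comm x v, mul_assoc, ← sq, inv_mul_le_iff₀ ha]
    exact h2
  have het : ∀ j, T (e j) = t j • e j := fun j => by
    exact hTs.apply_eigenvectorBasis hfr j
  have ht : ∀ j, 0 ≤ t j := by
    intro j
    have := hpos (e j)
    rw [het, inner_smul_right, real_inner_self_eq_norm_sq, e.orthonormal.1 j] at this
    simpa using this
  refine ⟨t, fun j => a⁻¹ * a⁻¹ * (inner ℝ (e j) v) ^ 2, ht, fun j => by positivity, ?_⟩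
  intro b hb hφ
  have hsb : ∀ i, s i + b ≠ 0 := fun i => (add_pos (hs i) hb).ne'
  have htb : ∀ j, t j + b ≠ 0 := fun j => (add_pos_of_nonneg_of_pos (ht j) hb).ne'
  set G := ∑ i, r i / (s i + b) with hG
  -- Sherman–Morrison: y = (D + b)⁻¹ v satisfies (T + b) y = (1 - G/a) v. Hence ⟨v, (T + b)⁻¹ v⟩ =
  -- aG/(a - G), and 1/(a - G) = 1/a + a⁻² · aG/(a - G).
  let y : EuclideanSpace ℝ ι := WithLp.toLp 2 fun i => √(r i) / (s i + b)
  have hvy : inner ℝ v y = G := by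
    rw [hinner]
    refine Finset.sum_congr rfl fun i _ => ?_
    change √(r i) * (√(r i) / (s i + b)) = _
    rw [← mul_div_assoc, Real.mul_self_sqrt (hr i)]
  have hTy : T y + b • y = ((a - G) / a) • v := by
    rw [hT, hvy]
    ext i
    change s i * (√(r i) / (s i + b)) - (a⁻¹ * G) * √(r i) + b * (√(r i) / (s i + b))
      = ((a - G) / a) * √(r i)
    have := hsb i
    field_simp
    ring
  have hey : ∀ j, inner ℝ (e j) y = ((a - G) / a) * inner ℝ (e j) v / (t j + b) := by
    intro j
    rw [eq_div_iff (htb j)]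
    have h1 : inner ℝ (e j) (T y + b • y) = inner ℝ (e j) y * (t j + b) := by
      rw [inner_add_right, ← hTs, het, inner_smul_left, inner_smul_right]
      simp only [conj_trivial]
      ring
    rw [← h1, hTy, inner_smul_right]
  have hG2 : G = ((a - G) / a) * ∑ j, (inner ℝ (e j) v) ^ 2 / (t j + b) := by
    conv_lhs => rw [← hvy, ← e.sum_inner_mul_inner v y]
    rw [Finset.mul_sum]
    refine Finset.sum_congr rfl fun j _ => ?_
    rw [hey, real_inner_comm]
    ring
  have hgoal : ∑ j, a⁻¹ * a⁻¹ * (inner ℝ (e j) v) ^ 2 * (t j + b)⁻¹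
      = a⁻¹ * a⁻¹ * ∑ j, (inner ℝ (e j) v) ^ 2 / (t j + b) := by
    rw [Finset.mul_sum]
    exact Finset.sum_congr rfl fun j _ => by ring
  rw [hgoal]
  set Q := ∑ j, (inner ℝ (e j) v) ^ 2 / (t j + b)
  field_simp
  field_simp at hG2
  linarith

/-- With s = (1 - u)/u, b times the kernel equals u⁻¹ (1 - s/(s + b)). The product is therefore a -
∑ r i/(s i + b) with r i = c i s i/u i and ∑ r i/s i = a, the borderline case of the resolvent
formula. Nodes are kept off 0 and 1 so that s is finite and positive; if all `c i` vanish, the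
convention 0⁻¹ = 0 makes the function zero. -/
theorem isStieltjes_inv_mul_sum {ι : Type*} [Fintype ι] (c : ι → ℝ) (u : ι → unitInterval)
    (hc : ∀ i, 0 ≤ c i) (hu : ∀ i, 0 < u i ∧ u i < 1) :
    IsStieltjes fun b => (b * ∑ i, c i * cauchyKernel b (u i))⁻¹ := by
  by_cases hcs : ∀ i, c i = 0
  · simpa [hcs] using IsStieltjes.zero
  push Not at hcs
  obtain ⟨i₀, hi₀⟩ := hcs
  have hu0 : ∀ i, 0 < (u i : ℝ) := fun i => (hu i).1
  have hu1 : ∀ i, (u i : ℝ) < 1 := fun i => (hu i).2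
  set s : ι → ℝ := fun i => (1 - u i) / u i with hs
  have hspos : ∀ i, 0 < s i := fun i => div_pos (by linarith [hu1 i]) (hu0 i)
  set a := ∑ i, c i / u i with ha
  have ha0 : 0 < a := Finset.sum_pos' (fun i _ => div_nonneg (hc i) (hu0 i).le)
    ⟨i₀, Finset.mem_univ _, div_pos (lt_of_le_of_ne (hc i₀) (Ne.symm hi₀)) (hu0 i₀)⟩
  obtain ⟨t, w, ht, hw, h⟩ := exists_inv_sub_sum_eq (fun i => c i / u i * s i) s a ha0
    (fun i => mul_nonneg (div_nonneg (hc i) (hu0 i).le) (hspos i).le) hspos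
    (le_of_eq (Finset.sum_congr rfl fun i _ => by
      have := (hspos i).ne'
      field_simp))
  refine ((IsStieltjes.const (inv_nonneg.2 ha0.le)).add
    (IsStieltjes.sum Finset.univ fun j _ => (IsStieltjes.inv_add (ht j)).const_mul (hw j))).congr
    fun b hb => ?_
  have key : b * ∑ i, c i * cauchyKernel b (u i) = a - ∑ i, c i / u i * s i / (s i + b) := by
    rw [ha, Finset.mul_sum, ← Finset.sum_sub_distrib]
    refine Finset.sum_congr rfl fun i _ => ?_
    have h1 := (hu0 i).ne'
    have h2 := (cauchyKernel_denom_pos hb (u i)).ne'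
    have h3 : s i + b = (1 + (b - 1) * u i) / u i := by
      simp only [hs]; field_simp; ring
    rw [h3, cauchyKernel]
    simp only [hs]
    field_simp
    ring
  rw [key, h b hb]
  rw [← key]
  refine (mul_pos hb (Finset.sum_pos' (fun i _ => mul_nonneg (hc i) (cauchyKernel_pos hb _).le)
    ⟨i₀, Finset.mem_univ _, mul_pos (lt_of_le_of_ne (hc i₀) (Ne.symm hi₀))
      (cauchyKernel_pos hb _)⟩)).ne'

/-- Push κ forward under simple functions that approximate the identity with values in the open
interval, which is dense; dominated convergence does the rest. -/
theorem exists_tendsto_sum_integral (κ : Measure unitInterval) [IsFiniteMeasure κ] :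
    ∃ (N : ℕ → Finset unitInterval) (c : ℕ → unitInterval → ℝ),
      (∀ n, ∀ u ∈ N n, 0 < u ∧ u < 1) ∧ (∀ n u, 0 ≤ c n u) ∧
      ∀ h : unitInterval → ℝ, Continuous h →
        Tendsto (fun n => ∑ u ∈ N n, c n u * h u) atTop (𝓝 (∫ u, h u ∂κ)) := by
  let s : Set unitInterval := Ioo 0 1
  have hhalf : (⟨1 / 2, by norm_num, by norm_num⟩ : unitInterval) ∈ s := by
    constructor
    · change (0 : ℝ) < 1 / 2; norm_num
    · change (1 / 2 : ℝ) < 1; norm_num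
  have hcl : ∀ u : unitInterval, u ∈ closure s := by
    intro u
    rw [closure_Ioo (by exact zero_ne_one)]
    exact ⟨u.2.1, u.2.2⟩
  let d : ℕ → SimpleFunc unitInterval unitInterval :=
    fun n => SimpleFunc.approxOn id measurable_id s _ hhalf n
  refine ⟨fun n => (d n).range, fun n u => κ.real (d n ⁻¹' {u}), ?_, ?_, ?_⟩
  · intro n u hu
    obtain ⟨v, rfl⟩ := SimpleFunc.mem_range.1 hu
    exact SimpleFunc.approxOn_mem measurable_id hhalf n v
  · exact fun n u => measureReal_nonneg
  · intro h hh
    have h1 : ∀ n, ∑ u ∈ (d n).range, κ.real (d n ⁻¹' {u}) * h u = ∫ u, h (d n u) ∂κ := by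
      intro n
      have : ∀ u, h (d n u) = ∑ v ∈ (d n).range, (d n ⁻¹' {v}).indicator (fun _ => h v) u := by
        intro u
        rw [Finset.sum_eq_single (d n u)]
        · simp
        · intro v _ hv
          simp [hv.symm]
        · intro hu
          exact absurd (SimpleFunc.mem_range_self _ _) hu
      simp_rw [this]
      rw [integral_finsetSum]
      · refine Finset.sum_congr rfl fun v _ => ?_
        rw [integral_indicator_const _ ((d n).measurableSet_fiber v), smul_eq_mul]
      · intro v _
        exact (integrable_const _).indicator ((d n).measurableSet_fiber v)
    simp_rw [h1]
    obtain ⟨C, hC⟩ := (isCompact_range hh).isBounded.exists_norm_le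
    refine tendsto_integral_of_dominated_convergence (fun _ => C) ?_ (integrable_const _) ?_ ?_
    · exact fun n => (hh.measurable.comp (d n).measurable).aestronglyMeasurable
    · exact fun n => Eventually.of_forall fun u => hC _ ⟨_, rfl⟩
    · refine Eventually.of_forall fun u => (hh.tendsto u).comp ?_
      exact SimpleFunc.tendsto_approxOn measurable_id hhalf (hcl u)

theorem IsStieltjes.pos_of_pos {F : ℝ → ℝ} (hF : IsStieltjes F) {b₀ : ℝ} (hb₀ : 0 < b₀)
    (h : F b₀ ≠ 0) {b : ℝ} (hb : 0 < b) : 0 < F b := by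
  obtain ⟨κ, hκ, hF⟩ := hF
  have hne : κ ≠ 0 := by
    rintro rfl
    exact h (by simp [hF b₀ hb₀])
  rw [hF b hb, integral_pos_iff_support_of_nonneg (fun u => (cauchyKernel_pos hb u).le)
    ((continuous_cauchyKernel hb).integrable_of_compactSpace κ)]
  have : Function.support (_root_.cauchyKernel b) = univ :=
    eq_univ_of_forall fun u => (cauchyKernel_pos hb u).ne'
  rw [this]
  exact (Measure.measure_univ_pos).2 hne

/-- If `S` is a non-zero Stieltjes function, then so is `b ↦ 1 / (b S(b))`. -/
theorem IsStieltjes.inv_mul {S : ℝ → ℝ} (hS : IsStieltjes S) (hne : S 1 ≠ 0) :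
    IsStieltjes fun b => (b * S b)⁻¹ := by
  have hpos : ∀ b, 0 < b → 0 < S b := fun b hb => hS.pos_of_pos one_pos hne hb
  obtain ⟨κ, hκ, hS⟩ := hS
  obtain ⟨N, c, hN, hc, h⟩ := exists_tendsto_sum_integral κ
  refine IsStieltjes.of_tendsto
    (F := fun n b => (b * ∑ u ∈ N n, c n u * _root_.cauchyKernel b u)⁻¹) ?_ ?_
  · intro n
    refine (isStieltjes_inv_mul_sum (ι := N n) (fun i => c n i) (fun i => i) (fun i => hc n i)
      (fun i => hN n i i.2)).congr fun b _ => ?_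
    rw [← Finset.sum_coe_sort (N n)]
  · intro b hb
    refine Tendsto.inv₀ (Tendsto.const_mul b ?_) (mul_pos hb (hpos b hb)).ne'
    rw [hS b hb]
    exact h _ (continuous_cauchyKernel hb)

/-! ### Bernstein's theorem -/

/-- Tonelli on the region x < y < z; this drives the induction in Taylor's formula at infinity. -/
theorem lintegral_Ioi_mul_lintegral_Ioi {F G : ℝ → ℝ≥0∞} (hF : Measurable F) (hG : Measurable G)
    (x : ℝ) :
    ∫⁻ y in Ioi x, F y * ∫⁻ z in Ioi y, G z = ∫⁻ z in Ioi x, G z * ∫⁻ y in Ioo x z, F y := by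
  have hm : Measurable fun p : ℝ × ℝ => {p : ℝ × ℝ | x < p.1 ∧ p.1 < p.2}.indicator
      (fun p => F p.1 * G p.2) p :=
    ((hF.comp measurable_fst).mul (hG.comp measurable_snd)).indicator
      ((measurableSet_lt measurable_const measurable_fst).inter
        (measurableSet_lt measurable_fst measurable_snd))
  have hswap := lintegral_lintegral_swap (μ := (volume : Measure ℝ)) (ν := (volume : Measure ℝ))
    (f := fun y z => {p : ℝ × ℝ | x < p.1 ∧ p.1 < p.2}.indicator (fun p => F p.1 * G p.2) (y, z))
    hm.aemeasurable
  have h1 : ∀ y, (∫⁻ z, {p : ℝ × ℝ | x < p.1 ∧ p.1 < p.2}.indicator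
      (fun p => F p.1 * G p.2) (y, z)) = (Ioi x).indicator (fun y => F y * ∫⁻ z in Ioi y, G z) y := by
    intro y
    by_cases hy : x < y
    · rw [indicator_of_mem (by exact hy), ← lintegral_const_mul _ hG, ← lintegral_indicator
        measurableSet_Ioi]
      refine lintegral_congr fun z => ?_
      simp only [indicator_apply, mem_ofPred_eq, mem_Ioi, hy, true_and]
    · rw [indicator_of_notMem (by exact hy)]
      simp [hy]
  have h2 : ∀ z, (∫⁻ y, {p : ℝ × ℝ | x < p.1 ∧ p.1 < p.2}.indicator
      (fun p => F p.1 * G p.2) (y, z)) = (Ioi x).indicator (fun z => G z * ∫⁻ y in Ioo x z, F y) z := by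
    intro z
    by_cases hz : x < z
    · rw [indicator_of_mem (by exact hz), ← lintegral_const_mul _ hF, ← lintegral_indicator
        measurableSet_Ioo]
      refine lintegral_congr fun y => ?_
      simp only [indicator_apply, mem_ofPred_eq, mem_Ioo, mul_comm]
    · rw [indicator_of_notMem (by exact hz)]
      have : ∀ y, ¬ (x < y ∧ y < z) := fun y hy => hz (hy.1.trans hy.2)
      simp [this]
  simp_rw [h1, h2] at hswap
  rwa [lintegral_indicator measurableSet_Ioi, lintegral_indicator measurableSet_Ioi] at hswap

/-- `g n = (-1)^n f⁽ⁿ⁾` for a completely monotone function `f = g 0` vanishing at infinity. -/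
structure CompletelyMonotoneFamily (g : ℕ → ℝ → ℝ) : Prop where
  nonneg : ∀ n y, 0 < y → 0 ≤ g n y
  hasDerivAt : ∀ n y, 0 < y → HasDerivAt (g n) (-g (n + 1) y) y
  measurable : ∀ n, Measurable (g (n + 1))
  tendsto_zero : Tendsto (g 0) atTop (𝓝 0)

namespace CompletelyMonotoneFamily

variable {g : ℕ → ℝ → ℝ}

theorem antitoneOn (hg : CompletelyMonotoneFamily g) (n : ℕ) : AntitoneOn (g n) (Ioi 0) := by
  refine antitoneOn_of_deriv_nonpos (convex_Ioi 0)
    (fun y hy => (hg.hasDerivAt n y hy).continuousAt.continuousWithinAt) ?_ ?_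
  · rw [interior_Ioi]
    exact fun y hy => (hg.hasDerivAt n y hy).differentiableAt.differentiableWithinAt
  · rw [interior_Ioi]
    intro y hy
    rw [(hg.hasDerivAt n y hy).deriv]
    exact neg_nonpos.2 (hg.nonneg _ y hy)

/-- By monotonicity and the mean value theorem on [y - 1, y], `g (n + 1) y` is at most g n (y - 1) -
g n y ≤ g n (y - 1). -/
theorem tendsto (hg : CompletelyMonotoneFamily g) (n : ℕ) : Tendsto (g n) atTop (𝓝 0) := by
  induction n with
  | zero => exact hg.tendsto_zero
  | succ n ih =>
    have h1 : Tendsto (fun y : ℝ => g n (y - 1)) atTop (𝓝 0) :=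
      ih.comp (tendsto_atTop_add_const_right _ (-1) tendsto_id)
    refine tendsto_of_tendsto_of_tendsto_of_le_of_le' tendsto_const_nhds h1 ?_ ?_
    · filter_upwards [eventually_gt_atTop 0] with y hy using hg.nonneg _ y hy
    · filter_upwards [eventually_gt_atTop 1] with y hy
      obtain ⟨c, hc, hc'⟩ := exists_hasDerivAt_eq_slope (g n) (fun z => -g (n + 1) z)
        (show y - 1 < y by linarith)
        (fun z hz => (hg.hasDerivAt n z (by linarith [hz.1])).continuousAt.continuousWithinAt)
        (fun z hz => hg.hasDerivAt n z (by linarith [hz.1]))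
      have h2 := hg.antitoneOn (n + 1) (show c ∈ Ioi 0 by simp; linarith [hc.1])
        (show y ∈ Ioi 0 by simp; linarith) hc.2.le
      have h3 := hg.nonneg n y (by linarith)
      rw [sub_sub_cancel, div_one] at hc'
      linarith

theorem ofReal_eq_lintegral (hg : CompletelyMonotoneFamily g) (n : ℕ) {x : ℝ} (hx : 0 < x) :
    ENNReal.ofReal (g n x) = ∫⁻ y in Ioi x, ENNReal.ofReal (g (n + 1) y) := by
  have hd : ∀ y ∈ Ici x, HasDerivAt (g n) (-g (n + 1) y) y :=
    fun y hy => hg.hasDerivAt n y (hx.trans_le hy)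
  have hn : ∀ y ∈ Ioi x, -g (n + 1) y ≤ 0 :=
    fun y hy => neg_nonpos.2 (hg.nonneg _ y (hx.trans hy))
  have hi := integrableOn_Ioi_deriv_of_nonpos' hd hn (hg.tendsto n)
  have hv := integral_Ioi_of_hasDerivAt_of_nonpos' hd hn (hg.tendsto n)
  rw [integral_neg, zero_sub, neg_inj] at hv
  rw [← hv, ofReal_integral_eq_lintegral_ofReal]
  · exact (integrable_neg_iff (f := g (n + 1))).1 hi
  · exact (ae_restrict_mem measurableSet_Ioi).mono fun y hy => hg.nonneg _ y (hx.trans hy)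

theorem lintegral_Ioo_pow (x z : ℝ) (n : ℕ) (hxz : x < z) :
    ∫⁻ y in Ioo x z, ENNReal.ofReal ((y - x) ^ n / n.factorial) =
      ENNReal.ofReal ((z - x) ^ (n + 1) / (n + 1).factorial) := by
  rw [← ofReal_integral_eq_lintegral_ofReal]
  · congr 1
    rw [← integral_Ioc_eq_integral_Ioo, ← intervalIntegral.integral_of_le hxz.le,
      intervalIntegral.integral_div, intervalIntegral.integral_comp_sub_right (fun y => y ^ n) x,
      integral_pow, sub_self, Nat.factorial_succ]
    push_cast
    have h1 : ((n : ℝ) + 1) ≠ 0 := by positivity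
    have h2 : (n.factorial : ℝ) ≠ 0 := by positivity
    field_simp
    simp
  · exact ((by fun_prop : Continuous fun y : ℝ => (y - x) ^ n / n.factorial).integrableOn_Icc
      (a := x) (b := z)).mono_set Ioo_subset_Icc_self
  · refine (ae_restrict_mem measurableSet_Ioo).mono fun y hy => ?_
    have : 0 ≤ y - x := by linarith [hy.1]
    exact div_nonneg (pow_nonneg this n) (Nat.cast_nonneg _)

/-- Taylor's formula with the base point at infinity. -/
theorem ofReal_eq_lintegral_pow (hg : CompletelyMonotoneFamily g) (n : ℕ) {x : ℝ} (hx : 0 < x) :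
    ENNReal.ofReal (g 0 x) =
      ∫⁻ y in Ioi x, ENNReal.ofReal (g (n + 1) y) * ENNReal.ofReal ((y - x) ^ n / n.factorial) := by
  induction n with
  | zero => simpa using hg.ofReal_eq_lintegral 0 hx
  | succ n ih =>
    rw [ih]
    have h1 : ∫⁻ y in Ioi x, ENNReal.ofReal (g (n + 1) y) *
        ENNReal.ofReal ((y - x) ^ n / n.factorial) = ∫⁻ y in Ioi x,
        ENNReal.ofReal ((y - x) ^ n / n.factorial) *
          ∫⁻ z in Ioi y, ENNReal.ofReal (g (n + 2) z) := by
      refine setLIntegral_congr_fun measurableSet_Ioi fun y hy => ?_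
      rw [← hg.ofReal_eq_lintegral (n + 1) (hx.trans hy), mul_comm]
    rw [h1, lintegral_Ioi_mul_lintegral_Ioi (by fun_prop) (hg.measurable _).ennreal_ofReal]
    refine setLIntegral_congr_fun measurableSet_Ioi fun z hz => ?_
    rw [lintegral_Ioo_pow x z n hz]

end CompletelyMonotoneFamily

/-- A bound uniform in t. With α = e^{-t} and β = (1 - t)⁺ one has αᴺ - βᴺ ≤ (α - β) N αᴺ⁻¹ for N =
n + 2, where α - β ≤ t² and ((n + 1) t)² e^{-(n + 1)t} ≤ 2. -/
theorem abs_exp_sub_max_pow_le {t : ℝ} (ht : 0 ≤ t) (n : ℕ) :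
    |Real.exp (-((n + 2 : ℕ) * t)) - max 0 (1 - t) ^ (n + 2)| ≤ 2 * (n + 2) / (n + 1) ^ 2 := by
  have h0 : Real.exp (-((n + 2 : ℕ) * t)) = Real.exp (-t) ^ (n + 2) := by
    rw [← Real.exp_nat_mul]; ring_nf
  have hle : max 0 (1 - t) ≤ Real.exp (-t) :=
    max_le (Real.exp_pos _).le (by linarith [Real.add_one_le_exp (-t)])
  have hdiff : Real.exp (-t) - max 0 (1 - t) ≤ t ^ 2 := by
    rcases le_or_gt t 1 with h | h
    · have := Real.abs_exp_sub_one_sub_id_le (x := -t) (by rw [abs_neg, abs_of_nonneg ht]; exact h)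
      have := (abs_le.1 this).2
      have := le_max_right 0 (1 - t)
      nlinarith
    · have h1 : Real.exp (-t) ≤ 1 := Real.exp_le_one_iff.2 (by linarith)
      have := le_max_left 0 (1 - t)
      nlinarith
  have hb := abs_pow_sub_pow_le (Real.exp (-t)) (max 0 (1 - t)) (n + 2)
  rw [h0]
  refine hb.trans ?_
  rw [abs_of_nonneg (sub_nonneg.2 hle), abs_of_pos (Real.exp_pos _),
    abs_of_nonneg (le_max_left 0 (1 - t)), max_eq_left hle]
  have hz : ((n + 1) * t) ^ 2 * Real.exp (-t) ^ (n + 1) ≤ 2 := by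
    have h1 := Real.quadratic_le_exp_of_nonneg (x := (n + 1) * t) (by positivity)
    have h2 : Real.exp (-t) ^ (n + 1) = (Real.exp ((n + 1) * t))⁻¹ := by
      rw [← Real.exp_nat_mul, ← Real.exp_neg]; push_cast; ring_nf
    rw [h2, ← div_eq_mul_inv, div_le_iff₀ (Real.exp_pos _)]
    have : 0 ≤ (n + 1) * t := by positivity
    nlinarith
  have hn : (0 : ℝ) < (n + 1) ^ 2 := by positivity
  rw [le_div_iff₀ hn]
  have he : 0 ≤ Real.exp (-t) ^ (n + 1) := by positivity
  have h3 : n + 2 - 1 = n + 1 := rfl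
  rw [h3]
  push_cast
  calc (Real.exp (-t) - max 0 (1 - t)) * (n + 2) * Real.exp (-t) ^ (n + 1) * (n + 1) ^ 2
      ≤ t ^ 2 * (n + 2) * Real.exp (-t) ^ (n + 1) * (n + 1) ^ 2 := by gcongr
    _ = (n + 2) * (((n + 1) * t) ^ 2 * Real.exp (-t) ^ (n + 1)) := by ring
    _ ≤ (n + 2) * 2 := by gcongr
    _ = _ := by ring

theorem tendsto_two_mul_add_two_div_sq :
    Tendsto (fun n : ℕ => 2 * ((n : ℝ) + 2) / (n + 1) ^ 2) atTop (𝓝 0) := by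
  have h1 : Tendsto (fun n : ℕ => 4 * (1 / ((n : ℝ) + 1))) atTop (𝓝 0) := by
    simpa using tendsto_one_div_add_atTop_nhds_zero_nat.const_mul (4 : ℝ)
  refine squeeze_zero (fun n => by positivity) (fun n => ?_) h1
  have : (0 : ℝ) < n + 1 := by positivity
  rw [div_le_iff₀ (by positivity)]
  field_simp
  nlinarith [(Nat.cast_nonneg n : (0 : ℝ) ≤ n)]

/-- Bernstein's theorem, for a completely monotone function that vanishes at infinity, away
from `0`. -/
theorem CompletelyMonotoneFamily.exists_eq_integral_rpow {g : ℕ → ℝ → ℝ}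
    (hg : CompletelyMonotoneFamily g) {ε : ℝ} (hε : 0 < ε) :
    ∃ τ : Measure unitInterval, IsFiniteMeasure τ ∧
      ∀ x, 0 < x → g 0 (ε + x) = ∫ v, (v : ℝ) ^ x ∂τ := by
  -- Taylor's formula at infinity at the point ε makes `M n`, with density `d n` on (ε, ∞), a
  -- measure of mass g(ε). The same formula at ε + x writes g(ε + x) as the `M n`-integral of (1 -
  -- x/(y - ε))⁺ to the power n + 2.
  let d : ℕ → ℝ → ℝ≥0∞ := fun n y =>
    ENNReal.ofReal (g (n + 3) y) * ENNReal.ofReal ((y - ε) ^ (n + 2) / (n + 2).factorial)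
  have hdm : ∀ n, Measurable (d n) := fun n =>
    (hg.measurable _).ennreal_ofReal.mul (by fun_prop)
  let M : ℕ → Measure ℝ := fun n => (volume.restrict (Ioi ε)).withDensity (d n)
  have hmass : ∀ n, M n univ = ENNReal.ofReal (g 0 ε) := fun n => by
    rw [withDensity_apply _ MeasurableSet.univ, Measure.restrict_univ,
      hg.ofReal_eq_lintegral_pow (n + 2) hε]
  have hfin : ∀ n, IsFiniteMeasure (M n) := fun n => ⟨by rw [hmass]; exact ENNReal.ofReal_lt_top⟩
  have hMae : ∀ n, ∀ᵐ y ∂(M n), ε < y := fun n =>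
    (withDensity_absolutelyContinuous _ _).ae_le (ae_restrict_mem measurableSet_Ioi)
  have hm1 : ∀ (n : ℕ) (x : ℝ), Measurable fun y => max 0 (1 - x / (y - ε)) ^ (n + 2) :=
    fun n x => by fun_prop
  have hMpow : ∀ n x, 0 < x → g 0 (ε + x) =
      ∫ y, max 0 (1 - x / (y - ε)) ^ (n + 2) ∂(M n) := by
    intro n x hx
    rw [integral_eq_lintegral_of_nonneg_ae (Eventually.of_forall fun y =>
      pow_nonneg (le_max_left _ _) _)
      (hm1 n x).aestronglyMeasurable, lintegral_withDensity_eq_lintegral_mul _ (hdm n) (by fun_prop)]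
    rw [← ENNReal.toReal_ofReal (hg.nonneg 0 (ε + x) (by positivity)),
      hg.ofReal_eq_lintegral_pow (n + 2) (show 0 < ε + x by positivity)]
    congr 1
    rw [← lintegral_indicator measurableSet_Ioi, ← lintegral_indicator measurableSet_Ioi]
    refine lintegral_congr fun y => ?_
    by_cases h1 : ε + x < y
    · have h2 : ε < y := by linarith
      have h3 : 0 < y - ε := by linarith
      rw [indicator_of_mem (by exact h1), indicator_of_mem (by exact h2)]
      simp only [d, Pi.mul_apply]
      rw [mul_assoc]
      congr 1
      rw [← ENNReal.ofReal_mul (by positivity)]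
      congr 1
      have h4 : 0 ≤ 1 - x / (y - ε) := by
        rw [sub_nonneg, div_le_one h3]; linarith
      rw [max_eq_right h4, div_mul_eq_mul_div, ← mul_pow, mul_sub, mul_div_cancel₀ _ h3.ne']
      ring_nf
    · rw [indicator_of_notMem (by exact h1)]
      by_cases h2 : ε < y
      · have h3 : 0 < y - ε := by linarith
        have h4 : 1 - x / (y - ε) ≤ 0 := by
          rw [sub_nonpos, one_le_div h3]; linarith [not_lt.1 h1]
        rw [indicator_of_mem (by exact h2)]
        simp only [Pi.mul_apply, max_eq_left h4]
        simp
      · rw [indicator_of_notMem (by exact h2)]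
  -- The truncated power is close to e^{-(n + 2) x/(y - ε)} = vˣ with v = e^{-(n + 2)/(y - ε)}. The
  -- `max` only keeps v in [0, 1] for y < ε, a null set for `M n`. The image measures on [0, 1] all
  -- have mass g(ε), so a weak limit exists.
  let V : ℕ → ℝ → unitInterval := fun n y =>
    ⟨Real.exp (-((n + 2 : ℕ) * max 0 (y - ε)⁻¹)), (Real.exp_pos _).le,
      Real.exp_le_one_iff.2 (by
        have : (0 : ℝ) ≤ max 0 (y - ε)⁻¹ := le_max_left _ _
        have : (0 : ℝ) ≤ (n + 2 : ℕ) * max 0 (y - ε)⁻¹ := by positivity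
        linarith)⟩
  have hV : ∀ n, Measurable (V n) := fun n => Measurable.subtype_mk (by fun_prop)
  have hκmass : ∀ n, ((M n).map (V n)) univ = ENNReal.ofReal (g 0 ε) := fun n => by
    rw [Measure.map_apply (hV n) MeasurableSet.univ, preimage_univ, hmass]
  have hκfin : ∀ n, IsFiniteMeasure ((M n).map (V n)) := fun n =>
    ⟨by rw [hκmass]; exact ENNReal.ofReal_lt_top⟩
  obtain ⟨τ, hτfin, hτ⟩ := exists_integral_eq_of_tendsto (fun n => (M n).map (V n)) hκfin
    (g 0 ε).toNNReal (fun n => (hκmass n).le)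
  refine ⟨τ, hτfin, fun x hx => (hτ (fun v => (v : ℝ) ^ x) ?_ _ ?_).symm⟩
  · exact (Real.continuous_rpow_const hx.le).comp continuous_subtype_val
  · have hcont : Continuous fun v : unitInterval => (v : ℝ) ^ x :=
      (Real.continuous_rpow_const hx.le).comp continuous_subtype_val
    have hint : ∀ n, ∫ v, (v : ℝ) ^ x ∂((M n).map (V n)) =
        ∫ y, Real.exp (-((n + 2 : ℕ) * (x / (y - ε)))) ∂(M n) := by
      intro n
      rw [integral_map (hV n).aemeasurable hcont.aestronglyMeasurable]
      refine integral_congr_ae ((hMae n).mono fun y hy => ?_)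
      have h3 : 0 < (y - ε)⁻¹ := inv_pos.2 (by linarith)
      simp only [V]
      rw [max_eq_right h3.le, ← Real.exp_mul]
      congr 1
      ring
    have hbound : ∀ n, |(∫ v, (v : ℝ) ^ x ∂((M n).map (V n))) - g 0 (ε + x)| ≤
        2 * (n + 2) / (n + 1) ^ 2 * g 0 ε := by
      intro n
      have i1 : Integrable (fun y => Real.exp (-((n + 2 : ℕ) * (x / (y - ε))))) (M n) := by
        have hm : Measurable fun y => Real.exp (-((n + 2 : ℕ) * (x / (y - ε)))) := by fun_prop
        refine Integrable.of_bound (C := 1) hm.aestronglyMeasurable ((hMae n).mono fun y hy => ?_)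
        have : 0 < y - ε := by linarith
        rw [Real.norm_of_nonneg (Real.exp_pos _).le, Real.exp_le_one_iff, neg_nonpos]
        positivity
      have i2 : Integrable (fun y => max 0 (1 - x / (y - ε)) ^ (n + 2)) (M n) := by
        refine Integrable.of_bound (C := 1) (hm1 n x).aestronglyMeasurable ((hMae n).mono fun y hy => ?_)
        have : 0 < y - ε := by linarith
        rw [Real.norm_of_nonneg (by positivity)]
        refine pow_le_one₀ (le_max_left _ _) (max_le zero_le_one ?_)
        have : 0 < x / (y - ε) := by positivity
        linarith
      rw [hint n, hMpow n x hx, ← integral_sub i1 i2, ← Real.norm_eq_abs]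
      refine (norm_integral_le_of_norm_le_const (C := 2 * (n + 2) / (n + 1) ^ 2)
        ((hMae n).mono fun y hy => ?_)).trans (le_of_eq ?_)
      · have : 0 < y - ε := by linarith
        exact abs_exp_sub_max_pow_le (by positivity) n
      · rw [Measure.real, hmass, ENNReal.toReal_ofReal (hg.nonneg 0 ε hε)]
    have hlim : Tendsto (fun n : ℕ => 2 * ((n : ℝ) + 2) / (n + 1) ^ 2 * g 0 ε) atTop (𝓝 0) := by
      simpa using tendsto_two_mul_add_two_div_sq.mul_const (g 0 ε)
    rw [tendsto_iff_dist_tendsto_zero]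
    refine squeeze_zero (fun n => dist_nonneg) (fun n => ?_) hlim
    rw [Real.dist_eq]
    exact hbound n

/-! ### From exponential mixtures to Stieltjes functions -/

/-- The divided difference between `1` and `b` of `b ↦ (e^{-bx} - 1) / b`. -/
noncomputable def laplaceKernel (x b : ℝ) : ℝ :=
  ((1 - Real.exp (-x)) - (1 - Real.exp (-(b * x))) / b) / (b - 1)

/-- Bernoulli's inequality for (1 + (e^{-x} - 1))ᵇ reverses at b = 1, exactly where b - 1 changes
sign. -/
theorem laplaceKernel_nonneg (x : ℝ) {b : ℝ} (hb : 0 < b) : 0 ≤ laplaceKernel x b := by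
  have hs : -1 ≤ Real.exp (-x) - 1 := by linarith [Real.exp_pos (-x)]
  have he : (1 + (Real.exp (-x) - 1)) ^ b = Real.exp (-(b * x)) := by
    rw [add_sub_cancel, ← Real.exp_mul]; ring_nf
  have hd : (1 - Real.exp (-x)) - (1 - Real.exp (-(b * x))) / b =
      (b * (1 - Real.exp (-x)) - (1 - Real.exp (-(b * x)))) / b := by
    field_simp
  rw [laplaceKernel, hd]
  rcases le_total 1 b with h | h
  · have := one_add_mul_self_le_rpow_one_add hs h
    rw [he] at this
    exact div_nonneg (div_nonneg (by linarith) hb.le) (by linarith)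
  · have := rpow_one_add_le_one_add_mul_self hs hb.le h
    rw [he] at this
    exact div_nonneg_of_nonpos (div_nonpos_of_nonpos_of_nonneg (by linarith) hb.le) (by linarith)

theorem measurable_laplaceKernel (b : ℝ) : Measurable fun x => laplaceKernel x b := by
  unfold laplaceKernel; fun_prop

theorem integrableOn_integral_laplaceKernel_mul_exp {s b : ℝ} (hs : 0 < s) (hb : 0 < b)
    (hb1 : b ≠ 1) :
    IntegrableOn (fun x => laplaceKernel x b * Real.exp (-(s * x))) (Ioi 0) ∧
      ∫ x in Ioi 0, laplaceKernel x b * Real.exp (-(s * x)) = 1 / (s * (s + 1) * (s + b)) := by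
  have hE : ∀ c : ℝ, 0 < c → IntegrableOn (fun x => Real.exp (-(c * x))) (Ioi 0) ∧
      ∫ x in Ioi 0, Real.exp (-(c * x)) = 1 / c := by
    intro c hc
    have h1 := integrableOn_exp_mul_Ioi (neg_neg_iff_pos.2 hc) 0
    have h2 := integral_exp_mul_Ioi (neg_neg_iff_pos.2 hc) 0
    simp only [neg_mul, mul_zero, Real.exp_zero] at h1 h2
    exact ⟨h1, by rw [h2, neg_div_neg_eq]⟩
  obtain ⟨i1, v1⟩ := hE s hs
  obtain ⟨i2, v2⟩ := hE (s + 1) (by linarith)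
  obtain ⟨i3, v3⟩ := hE (s + b) (by linarith)
  have hfun : (fun x => laplaceKernel x b * Real.exp (-(s * x))) = fun x =>
      (((Real.exp (-(s * x)) - Real.exp (-((s + 1) * x))) -
        (Real.exp (-(s * x)) - Real.exp (-((s + b) * x))) / b)) / (b - 1) := by
    funext x
    rw [laplaceKernel, div_mul_eq_mul_div, sub_mul, div_mul_eq_mul_div, sub_mul, sub_mul,
      ← Real.exp_add, ← Real.exp_add]
    ring_nf
  rw [hfun]
  have hb1' : b - 1 ≠ 0 := sub_ne_zero.2 hb1
  refine ⟨((i1.sub i2).sub ((i1.sub i3).div_const b)).div_const (b - 1), ?_⟩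
  have j1 : Integrable (fun x => Real.exp (-(s * x)) - Real.exp (-((s + 1) * x)))
    (volume.restrict (Ioi 0)) := i1.sub i2
  have j2 : Integrable (fun x => (Real.exp (-(s * x)) - Real.exp (-((s + b) * x))) / b)
    (volume.restrict (Ioi 0)) := (i1.sub i3).div_const b
  rw [integral_div, integral_sub j1 j2, integral_sub i1 i2,
    integral_div, integral_sub i1 i3, v1, v2, v3]
  have h1 : s + 1 ≠ 0 := by positivity
  have h2 : s + b ≠ 0 := by positivity
  field_simp
  ring

/-- The change of variables `s ↦ 1 / (1 + s)`, in the parametrization `v = e^{-s}`. -/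
noncomputable def logParam (v : unitInterval) : unitInterval :=
  ⟨(1 - Real.log v)⁻¹, by
    have := Real.log_nonpos v.2.1 v.2.2
    exact ⟨inv_nonneg.2 (by linarith), inv_le_one_of_one_le₀ (by linarith)⟩⟩

theorem measurable_logParam : Measurable logParam :=
  Measurable.subtype_mk (by fun_prop)

/-- With s = -log v this is 1/(s (1 + s)²), the factor in 1/(s (s + 1)(s + b)) = 1/(s (1 + s)²) · (1
+ s)/(b + s). At v = 0 the convention log 0 = 0 gives weight 0, in agreement with 0ˣ = 0 for x > 0.
-/
noncomputable def logWeight (v : unitInterval) : ℝ :=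
  1 / (-Real.log v * (1 - Real.log v) ^ 2)

theorem logWeight_nonneg (v : unitInterval) : 0 ≤ logWeight v := by
  have := Real.log_nonpos v.2.1 v.2.2
  exact div_nonneg zero_le_one (mul_nonneg (by linarith) (sq_nonneg _))

theorem measurable_logWeight : Measurable logWeight := by
  unfold logWeight; fun_prop

theorem lintegral_laplaceKernel_mul_rpow {b : ℝ} (hb : 0 < b) (hb1 : b ≠ 1) {v : unitInterval}
    (hv : v ≠ 1) :
    ∫⁻ x in Ioi 0, ENNReal.ofReal (laplaceKernel x b) * ENNReal.ofReal ((v : ℝ) ^ x) =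
      ENNReal.ofReal (logWeight v) * ENNReal.ofReal (cauchyKernel b (logParam v)) := by
  have hv1 : (v : ℝ) < 1 := lt_of_le_of_ne v.2.2 fun h => hv (Subtype.ext h)
  rcases eq_or_lt_of_le v.2.1 with h0 | h0
  · have h1 : logWeight v = 0 := by simp [logWeight, ← h0]
    rw [h1, ENNReal.ofReal_zero, zero_mul]
    refine (setLIntegral_congr_fun measurableSet_Ioi (g := fun _ => 0) fun x hx => ?_).trans
      lintegral_zero
    rw [← h0, Real.zero_rpow (ne_of_gt hx)]
    simp
  · set s := -Real.log v with hs
    have hspos : 0 < s := by have := Real.log_neg h0 hv1; linarith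
    obtain ⟨hi, hval⟩ := integrableOn_integral_laplaceKernel_mul_exp hspos hb hb1
    have h1 : ∀ x : ℝ, (v : ℝ) ^ x = Real.exp (-(s * x)) := fun x => by
      rw [Real.rpow_def_of_pos h0, hs]; ring_nf
    have h2 : ∫⁻ x in Ioi 0, ENNReal.ofReal (laplaceKernel x b) * ENNReal.ofReal ((v : ℝ) ^ x) =
        ∫⁻ x in Ioi 0, ENNReal.ofReal (laplaceKernel x b * Real.exp (-(s * x))) := by
      refine setLIntegral_congr_fun measurableSet_Ioi fun x hx => ?_
      rw [h1, ENNReal.ofReal_mul (laplaceKernel_nonneg x hb)]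
    rw [h2, ← ofReal_integral_eq_lintegral_ofReal hi, hval,
      ← ENNReal.ofReal_mul (logWeight_nonneg v)]
    · congr 1
      have hp := cauchyKernel_denom_pos hb (logParam v)
      have e1 : 1 - Real.log v = 1 + s := by rw [hs]; ring
      have e2 : (logParam v : ℝ) = (1 + s)⁻¹ := by rw [← e1]; rfl
      have h3 : 1 + s ≠ 0 := by positivity
      have h4 : s + b ≠ 0 := by positivity
      have h5 : 1 + s + (b - 1) ≠ 0 := by
        rw [show 1 + s + (b - 1) = s + b by ring]; exact h4
      rw [logWeight, cauchyKernel, e2, e1, ← hs]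
      field_simp
      ring
    · refine (ae_restrict_mem measurableSet_Ioi).mono fun x hx => ?_
      exact mul_nonneg (laplaceKernel_nonneg x hb) (Real.exp_pos _).le

/-- Finiteness at b = 2 bounds the total weight, because the kernel is at least 1/2 there; the
representing measure is the image of the weighted τ. -/
theorem IsStieltjes.of_lintegral {α : Type*} [MeasurableSpace α] (τ : Measure α)
    {w : α → ℝ≥0∞} (hw : Measurable w) {U : α → unitInterval} (hU : Measurable U)
    (hfin : ∫⁻ a, w a * ENNReal.ofReal (_root_.cauchyKernel 2 (U a)) ∂τ ≠ ∞) :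
    IsStieltjes fun b => (∫⁻ a, w a * ENNReal.ofReal (_root_.cauchyKernel b (U a)) ∂τ).toReal := by
  have hmass : ((τ.withDensity w).map U) univ ≠ ∞ := by
    rw [Measure.map_apply hU MeasurableSet.univ, preimage_univ,
      withDensity_apply _ MeasurableSet.univ, Measure.restrict_univ]
    refine ne_top_of_le_ne_top (ENNReal.mul_ne_top ENNReal.ofNat_ne_top hfin :
      2 * ∫⁻ a, w a * ENNReal.ofReal (_root_.cauchyKernel 2 (U a)) ∂τ ≠ ∞) ?_
    have hm : Measurable fun a => w a * ENNReal.ofReal (_root_.cauchyKernel 2 (U a)) :=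
      hw.mul ((continuous_cauchyKernel two_pos).measurable.comp hU).ennreal_ofReal
    rw [← lintegral_const_mul _ hm]
    refine lintegral_mono fun a => ?_
    have h1 : (1 : ℝ≥0∞) ≤ 2 * ENNReal.ofReal (_root_.cauchyKernel 2 (U a)) := by
      rw [← ENNReal.ofReal_ofNat, ← ENNReal.ofReal_mul zero_le_two, ENNReal.one_le_ofReal]
      have h2 := cauchyKernel_denom_pos two_pos (U a)
      simp only [_root_.cauchyKernel]
      rw [← div_eq_mul_inv, le_div_iff₀ h2]
      linarith [(U a).2.2]
    calc w a = w a * 1 := (mul_one _).symm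
      _ ≤ w a * (2 * ENNReal.ofReal (_root_.cauchyKernel 2 (U a))) := by gcongr
      _ = _ := by ring
  have : IsFiniteMeasure ((τ.withDensity w).map U) := ⟨hmass.lt_top⟩
  refine ⟨(τ.withDensity w).map U, this, fun b hb => ?_⟩
  have hc := (continuous_cauchyKernel hb).measurable
  rw [integral_eq_lintegral_of_nonneg_ae
    (Eventually.of_forall fun u => (cauchyKernel_pos hb u).le) hc.aestronglyMeasurable,
    lintegral_map hc.ennreal_ofReal hU,
    lintegral_withDensity_eq_lintegral_mul _ hw
      (g := fun a => ENNReal.ofReal (_root_.cauchyKernel b (U a))) (hc.comp hU).ennreal_ofReal]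
  rfl

/-- The shift by ε keeps away from a possible singularity at 0, so that Bernstein's theorem yields a
finite τ. Tonelli then reduces to a single exponential. -/
theorem CompletelyMonotoneFamily.exists_isStieltjes_shift {g : ℕ → ℝ → ℝ}
    (hg : CompletelyMonotoneFamily g) {ε : ℝ} (hε : 0 < ε)
    (hfin : ∫⁻ x in Ioi 0, ENNReal.ofReal (laplaceKernel x 2) * ENNReal.ofReal (g 0 (ε + x)) ≠ ∞) :
    ∃ R, IsStieltjes R ∧ ∀ b, 0 < b → b ≠ 1 → R b =
      (∫⁻ x in Ioi 0,
        ENNReal.ofReal (laplaceKernel x b) * ENNReal.ofReal (g 0 (ε + x))).toReal := by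
  obtain ⟨τ, hτ, hrep⟩ := hg.exists_eq_integral_rpow hε
  have hcont : ∀ x : ℝ, 0 < x → Continuous fun v : unitInterval => (v : ℝ) ^ x := fun x hx =>
    (Real.continuous_rpow_const hx.le).comp continuous_subtype_val
  -- An atom at v = 1 would be a constant component of g, excluded since g vanishes at infinity; for
  -- v = 1 the inner integral is not given by the kernel formula.
  have hone : τ {1} = 0 := by
    have h1 : ∀ x, 0 < x → τ.real {1} ≤ g 0 (ε + x) := by
      intro x hx
      rw [hrep x hx, ← integral_indicator_one (measurableSet_singleton _)]
      refine integral_mono ((integrable_const (1 : ℝ)).indicator (measurableSet_singleton _))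
        ((hcont x hx).integrable_of_compactSpace τ) fun v => ?_
      by_cases hv : v = 1
      · simp [hv]
      · simp only [indicator_of_notMem (show v ∉ ({1} : Set unitInterval) from hv)]
        exact Real.rpow_nonneg v.2.1 x
    have h2 : τ.real {1} ≤ 0 := by
      refine ge_of_tendsto (hg.tendsto_zero.comp (tendsto_atTop_add_const_left _ ε tendsto_id)) ?_
      filter_upwards [eventually_gt_atTop 0] with x hx using h1 x hx
    exact (measureReal_eq_zero_iff).1 (le_antisymm h2 measureReal_nonneg)
  have hae : ∀ᵐ v ∂τ, v ≠ 1 := by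
    rw [ae_iff]; simpa using hone
  have key : ∀ b, 0 < b → b ≠ 1 →
      ∫⁻ x in Ioi 0, ENNReal.ofReal (laplaceKernel x b) * ENNReal.ofReal (g 0 (ε + x)) =
        ∫⁻ v, ENNReal.ofReal (logWeight v) * ENNReal.ofReal (cauchyKernel b (logParam v)) ∂τ := by
    intro b hb hb1
    have e1 : ∫⁻ x in Ioi 0, ENNReal.ofReal (laplaceKernel x b) * ENNReal.ofReal (g 0 (ε + x)) =
        ∫⁻ x in Ioi (0 : ℝ), ∫⁻ v, ENNReal.ofReal (laplaceKernel x b) *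
          ENNReal.ofReal ((v : ℝ) ^ x) ∂τ := by
      refine setLIntegral_congr_fun measurableSet_Ioi fun x hx => ?_
      rw [lintegral_const_mul _ (hcont x hx).measurable.ennreal_ofReal, hrep x hx,
        ofReal_integral_eq_lintegral_ofReal ((hcont x hx).integrable_of_compactSpace τ)
          (Eventually.of_forall fun v => Real.rpow_nonneg v.2.1 x)]
    rw [e1, lintegral_lintegral_swap]
    · exact lintegral_congr_ae (hae.mono fun v hv => lintegral_laplaceKernel_mul_rpow hb hb1 hv)
    · refine Measurable.aemeasurable ?_
      have h1 : Measurable fun p : ℝ × unitInterval => laplaceKernel p.1 b :=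
        (measurable_laplaceKernel b).comp measurable_fst
      have h2 : Measurable fun p : ℝ × unitInterval => (p.2 : ℝ) ^ p.1 := by fun_prop
      exact h1.ennreal_ofReal.mul h2.ennreal_ofReal
  refine ⟨_, IsStieltjes.of_lintegral τ measurable_logWeight.ennreal_ofReal measurable_logParam ?_,
    fun b hb hb1 => by rw [key b hb hb1]⟩
  rwa [← key 2 two_pos (by norm_num)]

/-- Let ε decrease to 0: g(ε + x) increases to g(x), so monotone convergence applies, and Stieltjes
functions are closed under limits. -/
theorem CompletelyMonotoneFamily.exists_isStieltjes {g : ℕ → ℝ → ℝ}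
    (hg : CompletelyMonotoneFamily g)
    (hfin : ∀ b, 0 < b →
      ∫⁻ x in Ioi 0, ENNReal.ofReal (laplaceKernel x b) * ENNReal.ofReal (g 0 x) ≠ ∞) :
    ∃ R, IsStieltjes R ∧ ∀ b, 0 < b → b ≠ 1 → R b =
      (∫⁻ x in Ioi 0, ENNReal.ofReal (laplaceKernel x b) * ENNReal.ofReal (g 0 x)).toReal := by
  let ε : ℕ → ℝ := fun n => 1 / ((n : ℝ) + 1)
  have hε : ∀ n, 0 < ε n := fun n => by positivity
  have hεa : Antitone ε := fun m n h => one_div_le_one_div_of_le (by positivity) (by gcongr)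
  have hmono : ∀ x, 0 < x → Monotone fun n => g 0 (ε n + x) := fun x hx m n h =>
    hg.antitoneOn 0 (show 0 < ε n + x by have := hε n; positivity)
      (show 0 < ε m + x by have := hε m; positivity) (by linarith [hεa h])
  have hcont : ∀ n, ContinuousOn (fun x => g 0 (ε n + x)) (Ioi 0) := by
    intro n x hx
    have h1 := (hg.hasDerivAt 0 (ε n + x) (add_pos (hε n) hx)).continuousAt
    exact (ContinuousAt.comp (f := fun x => ε n + x) h1 (by fun_prop)).continuousWithinAt
  have hle : ∀ n b, ∫⁻ x in Ioi 0, ENNReal.ofReal (laplaceKernel x b) *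
      ENNReal.ofReal (g 0 (ε n + x)) ≤
        ∫⁻ x in Ioi 0, ENNReal.ofReal (laplaceKernel x b) * ENNReal.ofReal (g 0 x) := by
    intro n b
    refine setLIntegral_mono' measurableSet_Ioi fun x hx => ?_
    gcongr
    exact hg.antitoneOn 0 hx (show 0 < ε n + x by have := hε n; have : 0 < x := hx; positivity)
      (by linarith [hε n])
  choose R hR hRv using fun n => hg.exists_isStieltjes_shift (hε n)
    (ne_top_of_le_ne_top (hfin 2 two_pos) (hle n 2))
  refine IsStieltjes.exists_of_tendsto hR fun b hb hb1 => ?_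
  simp_rw [fun n => hRv n b hb hb1]
  refine (ENNReal.tendsto_toReal (hfin b hb)).comp ?_
  refine lintegral_tendsto_of_tendsto_of_monotone (fun n => ?_) ?_ ?_
  · exact (measurable_laplaceKernel b).ennreal_ofReal.aemeasurable.mul
      ((hcont n).aemeasurable measurableSet_Ioi).ennreal_ofReal
  · refine (ae_restrict_mem measurableSet_Ioi).mono fun x hx m n h => ?_
    simp only
    gcongr
    exact hmono x hx h
  · refine (ae_restrict_mem measurableSet_Ioi).mono fun x hx => ?_
    refine ENNReal.Tendsto.const_mul ?_ (Or.inr ENNReal.ofReal_ne_top)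
    refine (ENNReal.continuous_ofReal.tendsto _).comp ?_
    have h1 : Tendsto (fun n => ε n + x) atTop (𝓝 x) := by
      simpa [ε] using (tendsto_one_div_add_atTop_nhds_zero_nat (𝕜 := ℝ)).add_const x
    exact (hg.hasDerivAt 0 x hx).continuousAt.tendsto.comp h1

/-! ### Exponential moments of infinitely divisible laws without positive jumps -/

/-- The `k`-fold convolution power of `η`. -/
noncomputable def convPow (η : Measure ℝ) : ℕ → Measure ℝ
  | 0 => Measure.dirac 0
  | k + 1 => Measure.conv (convPow η k) η

instance isFiniteMeasure_convPow (η : Measure ℝ) [IsFiniteMeasure η] (k : ℕ) :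
    IsFiniteMeasure (convPow η k) := by
  induction k with
  | zero => unfold convPow; infer_instance
  | succ k ih => unfold convPow; infer_instance

theorem charFun_convPow (η : Measure ℝ) [IsFiniteMeasure η] (k : ℕ) (θ : ℝ) :
    charFun (convPow η k) θ = charFun η θ ^ k := by
  induction k with
  | zero => simp [convPow]
  | succ k ih => rw [convPow, charFun_conv, ih, pow_succ]

theorem lintegral_exp_conv (η η' : Measure ℝ) [SFinite η'] (l : ℝ) :
    ∫⁻ x, ENNReal.ofReal (Real.exp (l * x)) ∂(Measure.conv η η') =
      (∫⁻ x, ENNReal.ofReal (Real.exp (l * x)) ∂η) *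
        ∫⁻ x, ENNReal.ofReal (Real.exp (l * x)) ∂η' := by
  have hm : Measurable fun x : ℝ => ENNReal.ofReal (Real.exp (l * x)) := by fun_prop
  rw [Measure.lintegral_conv hm, ← lintegral_mul_const _ hm]
  refine lintegral_congr fun x => ?_
  rw [← lintegral_const_mul _ hm]
  refine lintegral_congr fun y => ?_
  rw [← ENNReal.ofReal_mul (Real.exp_pos _).le, ← Real.exp_add, mul_add]

theorem lintegral_exp_convPow (η : Measure ℝ) [IsFiniteMeasure η] (k : ℕ) (l : ℝ) :
    ∫⁻ x, ENNReal.ofReal (Real.exp (l * x)) ∂(convPow η k) =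
      (∫⁻ x, ENNReal.ofReal (Real.exp (l * x)) ∂η) ^ k := by
  induction k with
  | zero =>
    have hm : Measurable fun x : ℝ => ENNReal.ofReal (Real.exp (l * x)) := by fun_prop
    simp [convPow, lintegral_dirac' _ hm]
  | succ k ih => rw [convPow, lintegral_exp_conv, ih, pow_succ]

/-- The compound Poisson law with (finite) jump measure `η`. -/
noncomputable def compoundPoisson (η : Measure ℝ) : Measure ℝ :=
  Measure.sum fun k : ℕ =>
    ENNReal.ofReal (Real.exp (-η.real univ) / k.factorial) • convPow η k

theorem lintegral_exp_compoundPoisson (η : Measure ℝ) [IsFiniteMeasure η] (l : ℝ)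
    (hl : Integrable (fun x => Real.exp (l * x)) η) :
    ∫⁻ x, ENNReal.ofReal (Real.exp (l * x)) ∂(compoundPoisson η) =
      ENNReal.ofReal (Real.exp ((∫ x, Real.exp (l * x) ∂η) - η.real univ)) := by
  set L := ∫ x, Real.exp (l * x) ∂η with hL
  have hL0 : 0 ≤ L := integral_nonneg fun x => (Real.exp_pos _).le
  have h1 : ∫⁻ x, ENNReal.ofReal (Real.exp (l * x)) ∂η = ENNReal.ofReal L :=
    (ofReal_integral_eq_lintegral_ofReal hl (Eventually.of_forall fun x => (Real.exp_pos _).le)).symm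
  have hs : HasSum (fun k : ℕ => Real.exp (-η.real univ) / k.factorial * L ^ k)
      (Real.exp (L - η.real univ)) := by
    have := (NormedSpace.expSeries_div_hasSum_exp L).mul_left (Real.exp (-η.real univ))
    rw [← Real.exp_eq_exp_ℝ, ← Real.exp_add, neg_add_eq_sub] at this
    have he : (fun k : ℕ => Real.exp (-η.real univ) / k.factorial * L ^ k) =
        fun k : ℕ => Real.exp (-η.real univ) * (L ^ k / k.factorial) := by funext k; ring
    rwa [he]
  rw [compoundPoisson, lintegral_sum_measure]
  simp_rw [lintegral_smul_measure, lintegral_exp_convPow, h1, smul_eq_mul]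
  rw [← hs.tsum_eq, ENNReal.ofReal_tsum_of_nonneg (fun k => by positivity) hs.summable]
  refine tsum_congr fun k => ?_
  rw [ENNReal.ofReal_mul (by positivity), ENNReal.ofReal_pow hL0]

instance isProbabilityMeasure_compoundPoisson (η : Measure ℝ) [IsFiniteMeasure η] :
    IsProbabilityMeasure (compoundPoisson η) := by
  have := lintegral_exp_compoundPoisson η 0 (by simp)
  exact ⟨by simpa using this⟩

theorem charFun_compoundPoisson (η : Measure ℝ) [IsFiniteMeasure η] (θ : ℝ) :
    charFun (compoundPoisson η) θ = Complex.exp (charFun η θ - η.real univ) := by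
  have hint : Integrable (fun x : ℝ => Complex.exp (θ * x * Complex.I)) (compoundPoisson η) := by
    refine Integrable.of_bound (C := 1) (by fun_prop) (Eventually.of_forall fun x => ?_)
    rw [← Complex.ofReal_mul, Complex.norm_exp_ofReal_mul_I]
  rw [charFun_apply_real]
  have h1 := hasSum_integral_measure (μ := fun k : ℕ =>
    ENNReal.ofReal (Real.exp (-η.real univ) / k.factorial) • convPow η k) hint
  refine h1.unique ?_
  have := (NormedSpace.expSeries_div_hasSum_exp (charFun η θ)).mul_left
    (Complex.exp (-(η.real univ : ℂ)))
  rw [← Complex.exp_eq_exp_ℂ, ← Complex.exp_add, neg_add_eq_sub] at this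
  refine (congrArg (fun f : ℕ → ℂ => HasSum f _) (funext fun k => ?_)).mpr this
  rw [integral_smul_measure, ENNReal.toReal_ofReal (by positivity), ← charFun_apply_real,
    charFun_convPow, Complex.real_smul]
  push_cast
  ring

theorem integrable_ite_abs_lt_one (η : Measure ℝ) [IsFiniteMeasure η] :
    Integrable (fun x : ℝ => if |x| < 1 then x else 0) η := by
  refine Integrable.of_bound (C := 1) (Measurable.aestronglyMeasurable ?_)
    (Eventually.of_forall fun x => ?_)
  · exact Measurable.ite (measurableSet_lt (by fun_prop) measurable_const) measurable_id
      measurable_const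
  · split_ifs with h
    · exact h.le
    · simp

/-- The Laplace exponent associated to a triplet by the Lévy-Khintchine formula. -/
noncomputable def levyLaplaceExponent (μ σ : ℝ) (ν : Measure ℝ) (l : ℝ) : ℝ :=
  -μ * l + σ ^ 2 / 2 * l ^ 2 + ∫ x, (Real.exp (l * x) - 1 - (if |x| < 1 then l * x else 0)) ∂ν

/-- The infinitely divisible law with triplet `(μ, σ, η)`, `η` finite. -/
noncomputable def levyLaw (μ σ : ℝ) (η : Measure ℝ) : Measure ℝ :=
  Measure.conv
    (gaussianReal (-μ - ∫ x, (if |x| < 1 then x else 0) ∂η) (σ ^ 2).toNNReal)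
    (compoundPoisson η)

instance isProbabilityMeasure_levyLaw (μ σ : ℝ) (η : Measure ℝ) [IsFiniteMeasure η] :
    IsProbabilityMeasure (levyLaw μ σ η) := by
  unfold levyLaw; infer_instance

theorem charFun_levyLaw (μ σ : ℝ) (η : Measure ℝ) [IsFiniteMeasure η] (θ : ℝ) :
    charFun (levyLaw μ σ η) θ = Complex.exp (-levyKhintchineExponent μ σ η θ) := by
  rw [levyLaw, charFun_conv, charFun_gaussianReal, charFun_compoundPoisson, ← Complex.exp_add]
  congr 1
  have hint : Integrable (fun x : ℝ => Complex.exp (Complex.I * θ * x)) η := by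
    refine Integrable.of_bound (C := 1) (by fun_prop) (Eventually.of_forall fun x => ?_)
    rw [mul_assoc, ← Complex.ofReal_mul, mul_comm, Complex.norm_exp_ofReal_mul_I]
  have hite : (fun x : ℝ => if |x| < 1 then Complex.I * θ * x else 0) =
      fun x : ℝ => Complex.I * θ * ((if |x| < 1 then x else 0 : ℝ) : ℂ) := by
    funext x; split_ifs <;> simp
  have hi2 : Integrable (fun x : ℝ => Complex.I * θ * ((if |x| < 1 then x else 0 : ℝ) : ℂ)) η :=
    ((integrable_ite_abs_lt_one η).ofReal).const_mul _
  have hi1 : Integrable (fun x : ℝ => 1 - Complex.exp (Complex.I * θ * x)) η :=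
    (integrable_const _).sub hint
  rw [levyKhintchineExponent, integral_add hi1 (by rw [hite]; exact hi2),
    integral_sub (integrable_const _) hint, hite, integral_const_mul, integral_complex_ofReal,
    charFun_apply_real]
  have : ∫ x : ℝ, Complex.exp (θ * x * Complex.I) ∂η = ∫ x : ℝ, Complex.exp (Complex.I * θ * x) ∂η :=
    integral_congr_ae (Eventually.of_forall fun x => by ring_nf)
  rw [this]
  simp only [integral_const, Real.coe_toNNReal _ (sq_nonneg σ)]
  push_cast
  simp
  ring

theorem lintegral_exp_levyLaw (μ σ : ℝ) (η : Measure ℝ) [IsFiniteMeasure η] (l : ℝ)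
    (hl : Integrable (fun x => Real.exp (l * x)) η) :
    ∫⁻ x, ENNReal.ofReal (Real.exp (l * x)) ∂(levyLaw μ σ η) =
      ENNReal.ofReal (Real.exp (levyLaplaceExponent μ σ η l)) := by
  rw [levyLaw, lintegral_exp_conv, lintegral_exp_compoundPoisson η l hl,
    ← ofReal_integral_eq_lintegral_ofReal (integrable_exp_mul_gaussianReal l)
      (Eventually.of_forall fun x => (Real.exp_pos _).le)]
  have h1 := congrFun (mgf_id_gaussianReal
    (μ := -μ - ∫ x, (if |x| < 1 then x else 0) ∂η) (v := (σ ^ 2).toNNReal)) l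
  simp only [mgf, id] at h1
  rw [h1, ← ENNReal.ofReal_mul (Real.exp_pos _).le, ← Real.exp_add]
  congr 2
  have hite : (fun x : ℝ => if |x| < 1 then l * x else 0) =
      fun x : ℝ => l * (if |x| < 1 then x else 0) := by
    funext x; split_ifs <;> simp
  have hi2 : Integrable (fun x : ℝ => l * (if |x| < 1 then x else 0)) η :=
    (integrable_ite_abs_lt_one η).const_mul _
  have hi1 : Integrable (fun x : ℝ => Real.exp (l * x) - 1) η := hl.sub (integrable_const _)
  rw [levyLaplaceExponent, integral_sub hi1 (by rw [hite]; exact hi2),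
    integral_sub hl (integrable_const _), hite, integral_const_mul]
  simp only [integral_const, Real.coe_toNNReal _ (sq_nonneg σ), smul_eq_mul, mul_one]
  ring

namespace IsLevyMeasure

variable {ν : Measure ℝ}

theorem integrable_min (hν : IsLevyMeasure ν) : Integrable (fun x : ℝ => min 1 (x ^ 2)) ν := by
  refine ⟨by fun_prop, ?_⟩
  rw [hasFiniteIntegral_iff_ofReal (Eventually.of_forall fun x => by positivity)]
  exact hν.lintegral_lt_top

theorem measurable_ite (c : ℝ) : Measurable fun x : ℝ => if |x| < 1 then c * x else 0 :=
  Measurable.ite (measurableSet_lt (by fun_prop) measurable_const) (by fun_prop) measurable_const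

theorem integrable_exponent (hν : IsLevyMeasure ν) (θ : ℝ) :
    Integrable (fun x : ℝ => 1 - Complex.exp (Complex.I * θ * x) +
      (if |x| < 1 then Complex.I * θ * x else 0)) ν := by
  have hmeas : Measurable fun x : ℝ => if |x| < 1 then Complex.I * θ * (x : ℂ) else 0 :=
    Measurable.ite (measurableSet_lt (by fun_prop) measurable_const) (by fun_prop) measurable_const
  refine (hν.integrable_min.const_mul (2 * θ ^ 2 + 2)).mono'
    (Measurable.aestronglyMeasurable (by fun_prop)) (Eventually.of_forall fun x => ?_)
  have hy : Complex.I * θ * x = Complex.I * ((θ * x : ℝ) : ℂ) := by push_cast; ring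
  rw [hy]
  have hn : ‖Complex.I * ((θ * x : ℝ) : ℂ)‖ = |θ * x| := by
    rw [norm_mul, Complex.norm_I, one_mul, Complex.norm_real, Real.norm_eq_abs]
  have h1 : ‖Complex.exp (Complex.I * ((θ * x : ℝ) : ℂ))‖ = 1 := by
    rw [mul_comm, Complex.norm_exp_ofReal_mul_I]
  split_ifs with h
  · have hx : x ^ 2 ≤ 1 := by
      rw [← sq_abs]; nlinarith [abs_nonneg x]
    rw [min_eq_right hx]
    have hb : ‖1 - Complex.exp (Complex.I * ((θ * x : ℝ) : ℂ)) + Complex.I * ((θ * x : ℝ) : ℂ)‖ ≤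
        2 * (θ * x) ^ 2 := by
      have e : 1 - Complex.exp (Complex.I * ((θ * x : ℝ) : ℂ)) + Complex.I * ((θ * x : ℝ) : ℂ) =
        -(Complex.exp (Complex.I * ((θ * x : ℝ) : ℂ)) - 1 - Complex.I * ((θ * x : ℝ) : ℂ)) := by ring
      rw [e, norm_neg]
      rcases le_or_gt |θ * x| 1 with h2 | h2
      · refine (Complex.norm_exp_sub_one_sub_id_le (by rw [hn]; exact h2)).trans ?_
        rw [hn, sq_abs]
        nlinarith [sq_nonneg (θ * x)]
      · refine (norm_sub_le _ _).trans ?_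
        have h3 : ‖Complex.exp (Complex.I * ((θ * x : ℝ) : ℂ)) - 1‖ ≤ |θ * x| :=
          Real.norm_exp_I_mul_ofReal_sub_one_le
        rw [hn, ← sq_abs]
        nlinarith
    refine hb.trans ?_
    nlinarith [sq_nonneg x, sq_nonneg θ]
  · have hx : 1 ≤ x ^ 2 := by
      rw [← sq_abs]; nlinarith [not_lt.1 h]
    rw [min_eq_left hx, add_zero, mul_one]
    refine (norm_sub_le _ _).trans ?_
    rw [h1, norm_one]
    nlinarith [sq_nonneg θ]

theorem ae_neg (hν : IsLevyMeasure ν) (h0 : ν (Ioi 0) = 0) : ∀ᵐ x ∂ν, x < 0 := by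
  rw [ae_iff]
  have : {a : ℝ | ¬ a < 0} = {0} ∪ Ioi 0 := by
    ext a; simp [le_iff_eq_or_lt, eq_comm]
  rw [this]
  exact measure_union_null hν.zero h0

theorem integrable_laplace (hν : IsLevyMeasure ν) (h0 : ν (Ioi 0) = 0) {l : ℝ} (hl : 0 ≤ l) :
    Integrable (fun x : ℝ => Real.exp (l * x) - 1 - (if |x| < 1 then l * x else 0)) ν := by
  have hmeas := measurable_ite l
  refine (hν.integrable_min.const_mul (2 * l ^ 2 + 1)).mono'
    (Measurable.aestronglyMeasurable (by fun_prop)) ((hν.ae_neg h0).mono fun x hx => ?_)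
  have hlx : l * x ≤ 0 := mul_nonpos_of_nonneg_of_nonpos hl hx.le
  have he : Real.exp (l * x) ≤ 1 := Real.exp_le_one_iff.2 hlx
  have he0 := Real.exp_pos (l * x)
  rw [Real.norm_eq_abs]
  split_ifs with h
  · have hx2 : x ^ 2 ≤ 1 := by
      rw [← sq_abs]; nlinarith [abs_nonneg x]
    rw [min_eq_right hx2]
    have hb : |Real.exp (l * x) - 1 - l * x| ≤ 2 * (l * x) ^ 2 := by
      rcases le_or_gt |l * x| 1 with h2 | h2
      · refine (Real.abs_exp_sub_one_sub_id_le h2).trans ?_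
        nlinarith [sq_nonneg (l * x)]
      · rw [abs_of_neg (lt_of_le_of_ne hlx (by rintro h3; rw [h3] at h2; norm_num at h2))] at h2
        rw [abs_le]
        constructor <;> nlinarith
    refine hb.trans ?_
    nlinarith [sq_nonneg x, sq_nonneg l]
  · have hx2 : 1 ≤ x ^ 2 := by
      rw [← sq_abs]; nlinarith [not_lt.1 h]
    rw [min_eq_left hx2, sub_zero, mul_one, abs_le]
    constructor <;> nlinarith [sq_nonneg l]

theorem isFiniteMeasure_restrict (hν : IsLevyMeasure ν) {δ : ℝ} (hδ : 0 < δ) :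
    IsFiniteMeasure (ν.restrict (Iic (-δ))) := by
  refine ⟨?_⟩
  rw [Measure.restrict_apply_univ]
  have hc : 0 < min 1 (δ ^ 2) := by positivity
  have h1 := meas_ge_le_lintegral_div (μ := ν) (f := fun x : ℝ => ENNReal.ofReal (min 1 (x ^ 2)))
    (by fun_prop) (ε := ENNReal.ofReal (min 1 (δ ^ 2))) (by simpa using hδ.ne')
    ENNReal.ofReal_ne_top
  refine lt_of_le_of_lt ((measure_mono ?_).trans h1)
    (ENNReal.div_lt_top hν.lintegral_lt_top.ne (by simpa using hδ.ne'))
  intro x hx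
  have hx' : x ≤ -δ := hx
  refine ENNReal.ofReal_le_ofReal (min_le_min_left _ ?_)
  nlinarith

theorem tendsto_setIntegral (hν : IsLevyMeasure ν) (h0 : ν (Ioi 0) = 0) {E : Type*}
    [NormedAddCommGroup E] [NormedSpace ℝ E] {h : ℝ → E} (hh : Integrable h ν) :
    Tendsto (fun n : ℕ => ∫ x in Iic (-(1 / ((n : ℝ) + 1))), h x ∂ν) atTop (𝓝 (∫ x, h x ∂ν)) := by
  have hmono : Monotone fun n : ℕ => Iic (-(1 / ((n : ℝ) + 1))) := fun m n hmn =>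
    Iic_subset_Iic.2 (neg_le_neg (one_div_le_one_div_of_le (by positivity) (by gcongr)))
  have h1 := tendsto_setIntegral_of_monotone (μ := ν) (f := h)
    (fun n : ℕ => measurableSet_Iic (a := -(1 / ((n : ℝ) + 1)))) hmono hh.integrableOn
  have h2 : ∫ x in ⋃ n : ℕ, Iic (-(1 / ((n : ℝ) + 1))), h x ∂ν = ∫ x, h x ∂ν := by
    rw [Measure.restrict_eq_self_of_ae_mem]
    refine (hν.ae_neg h0).mono fun x hx => ?_
    obtain ⟨n, hn⟩ := exists_nat_one_div_lt (neg_pos.2 hx)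
    exact mem_iUnion.2 ⟨n, by rw [mem_Iic]; linarith⟩
  rwa [h2] at h1

end IsLevyMeasure

/-- Convergence of exponential moments along a weakly convergent sequence. -/
theorem integrable_exp_of_tendsto {m : ProbabilityMeasure ℝ} {Y : ℕ → ProbabilityMeasure ℝ}
    (hY : Tendsto Y atTop (𝓝 m)) {l : ℝ} {c c₂ : ℕ → ℝ} {c' c₂' : ℝ}
    (h1 : ∀ n, ∫⁻ x, ENNReal.ofReal (Real.exp (l * x)) ∂(Y n : Measure ℝ) = ENNReal.ofReal (c n))
    (h2 : ∀ n, ∫⁻ x, ENNReal.ofReal (Real.exp (2 * l * x)) ∂(Y n : Measure ℝ) =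
      ENNReal.ofReal (c₂ n))
    (hc0 : ∀ n, 0 ≤ c n) (hc20 : ∀ n, 0 ≤ c₂ n)
    (hc : Tendsto c atTop (𝓝 c')) (hc2 : Tendsto c₂ atTop (𝓝 c₂')) :
    Integrable (fun x => Real.exp (l * x)) (m : Measure ℝ) ∧
      ∫ x, Real.exp (l * x) ∂(m : Measure ℝ) = c' := by
  have hint : ∀ n, Integrable (fun x => Real.exp (l * x)) (Y n : Measure ℝ) := fun n =>
    ⟨by fun_prop, by
      rw [hasFiniteIntegral_iff_ofReal (Eventually.of_forall fun x => (Real.exp_pos _).le), h1]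
      exact ENNReal.ofReal_lt_top⟩
  have hint2 : ∀ n, Integrable (fun x => Real.exp (2 * l * x)) (Y n : Measure ℝ) := fun n =>
    ⟨by fun_prop, by
      rw [hasFiniteIntegral_iff_ofReal (Eventually.of_forall fun x => (Real.exp_pos _).le), h2]
      exact ENNReal.ofReal_lt_top⟩
  have hv : ∀ n, ∫ x, Real.exp (l * x) ∂(Y n : Measure ℝ) = c n := fun n => by
    rw [integral_eq_lintegral_of_nonneg_ae (Eventually.of_forall fun x => (Real.exp_pos _).le)
      (by fun_prop), h1, ENNReal.toReal_ofReal (hc0 n)]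
  have hv2 : ∀ n, ∫ x, Real.exp (2 * l * x) ∂(Y n : Measure ℝ) = c₂ n := fun n => by
    rw [integral_eq_lintegral_of_nonneg_ae (Eventually.of_forall fun x => (Real.exp_pos _).le)
      (by fun_prop), h2, ENNReal.toReal_ofReal (hc20 n)]
  have hb : ∀ K : ℕ, ∀ x, ‖min (Real.exp (l * x)) (K + 1)‖ ≤ K + 1 := fun K x => by
    rw [Real.norm_of_nonneg (by positivity)]
    exact min_le_right _ _
  have htrunc : ∀ K : ℕ, Tendsto (fun n => ∫ x, min (Real.exp (l * x)) (K + 1) ∂(Y n : Measure ℝ))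
      atTop (𝓝 (∫ x, min (Real.exp (l * x)) (K + 1) ∂(m : Measure ℝ))) := fun K =>
    (ProbabilityMeasure.tendsto_iff_forall_integral_tendsto.1 hY)
      (BoundedContinuousFunction.ofNormedAddCommGroup (fun x => min (Real.exp (l * x)) (K + 1))
        (by fun_prop) (K + 1) (hb K))
  have hti : ∀ (K : ℕ) (p : ProbabilityMeasure ℝ),
      Integrable (fun x => min (Real.exp (l * x)) (K + 1)) (p : Measure ℝ) := fun K p =>
    Integrable.of_bound (C := K + 1) (Continuous.aestronglyMeasurable (by fun_prop))
      (Eventually.of_forall (hb K))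
  have hup : ∀ K : ℕ, ∫ x, min (Real.exp (l * x)) (K + 1) ∂(m : Measure ℝ) ≤ c' := fun K =>
    le_of_tendsto_of_tendsto' (htrunc K) hc fun n => by
      rw [← hv n]
      exact integral_mono (hti K _) (hint n) fun x => min_le_left _ _
  -- For e = e^{lx}, both e - e²/(K + 1) ≤ e and, by the arithmetic–geometric inequality, e - e²/(K
  -- + 1) ≤ K + 1. The moment at 2l thus provides the uniform integrability.
  have hlow : ∀ K : ℕ, c' - c₂' / (K + 1) ≤ ∫ x, min (Real.exp (l * x)) (K + 1) ∂(m : Measure ℝ) :=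
    fun K => le_of_tendsto_of_tendsto' (hc.sub (hc2.div_const _)) (htrunc K) fun n => by
      rw [← hv n, ← hv2 n, ← integral_div, ← integral_sub (hint n) ((hint2 n).div_const _)]
      refine integral_mono ((hint n).sub ((hint2 n).div_const _)) (hti K _) fun x => ?_
      have hK : (0 : ℝ) < K + 1 := by positivity
      have he := Real.exp_pos (l * x)
      have h4 : Real.exp (2 * l * x) = Real.exp (l * x) ^ 2 := by
        rw [← Real.exp_nat_mul]; push_cast; ring_nf
      simp only [h4]
      refine le_min ?_ ?_
      · have : 0 ≤ Real.exp (l * x) ^ 2 / (K + 1) := by positivity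
        linarith
      · rw [sub_le_iff_le_add, ← sub_le_iff_le_add', le_div_iff₀ hK]
        nlinarith [sq_nonneg (Real.exp (l * x) - (K + 1))]
  have hlim : Tendsto (fun K : ℕ => ∫ x, min (Real.exp (l * x)) (K + 1) ∂(m : Measure ℝ)) atTop
      (𝓝 c') := by
    refine tendsto_of_tendsto_of_tendsto_of_le_of_le ?_ tendsto_const_nhds hlow hup
    have := (tendsto_one_div_add_atTop_nhds_zero_nat (𝕜 := ℝ)).const_mul c₂'
    simpa [div_eq_mul_inv] using this.const_sub c'
  have hmono : ∀ᵐ x ∂(m : Measure ℝ),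
      Monotone fun K : ℕ => ENNReal.ofReal (min (Real.exp (l * x)) (K + 1)) :=
    Eventually.of_forall fun x K K' hKK => ENNReal.ofReal_le_ofReal
      (min_le_min_left _ (by gcongr))
  have htt : ∀ᵐ x ∂(m : Measure ℝ), Tendsto (fun K : ℕ =>
      ENNReal.ofReal (min (Real.exp (l * x)) (K + 1))) atTop
        (𝓝 (ENNReal.ofReal (Real.exp (l * x)))) :=
    Eventually.of_forall fun x => by
      refine tendsto_const_nhds.congr' ?_
      obtain ⟨N, hN⟩ := exists_nat_ge (Real.exp (l * x))
      filter_upwards [eventually_ge_atTop N] with K hK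
      have : (N : ℝ) ≤ K := by exact_mod_cast hK
      rw [min_eq_left (by linarith)]
  have hmct := lintegral_tendsto_of_tendsto_of_monotone (fun K => by fun_prop) hmono htt
  have heq : ∫⁻ x, ENNReal.ofReal (Real.exp (l * x)) ∂(m : Measure ℝ) = ENNReal.ofReal c' := by
    refine tendsto_nhds_unique hmct ?_
    refine ((ENNReal.continuous_ofReal.tendsto _).comp hlim).congr fun K => ?_
    exact ofReal_integral_eq_lintegral_ofReal (hti K m) (Eventually.of_forall fun x => by positivity)
  have hc' : 0 ≤ c' := ge_of_tendsto' hc hc0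
  refine ⟨⟨by fun_prop, ?_⟩, ?_⟩
  · rw [hasFiniteIntegral_iff_ofReal (Eventually.of_forall fun x => (Real.exp_pos _).le), heq]
    exact ENNReal.ofReal_lt_top
  · rw [integral_eq_lintegral_of_nonneg_ae (Eventually.of_forall fun x => (Real.exp_pos _).le)
      (by fun_prop), heq, ENNReal.toReal_ofReal hc']

/-- The exponential moments of an infinitely divisible law without positive jumps. -/
theorem integral_exp_eq_of_charFun {ν : Measure ℝ} (hν : IsLevyMeasure ν) (h0 : ν (Ioi 0) = 0)
    (μ σ : ℝ) (m : Measure ℝ) [IsProbabilityMeasure m]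
    (hm : ∀ θ : ℝ, charFun m θ = Complex.exp (-levyKhintchineExponent μ σ ν θ)) {l : ℝ}
    (hl : 0 ≤ l) :
    Integrable (fun x => Real.exp (l * x)) m ∧
      ∫ x, Real.exp (l * x) ∂m = Real.exp (levyLaplaceExponent μ σ ν l) := by
  -- Discarding the small jumps leaves finite jump measures, for which the law is explicit. The
  -- characteristic functions converge, hence so do the laws, and the exponential moments at l and
  -- 2l converge as well.
  let η : ℕ → Measure ℝ := fun n => ν.restrict (Iic (-(1 / ((n : ℝ) + 1))))
  have hη : ∀ n, IsFiniteMeasure (η n) := fun n => hν.isFiniteMeasure_restrict (by positivity)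
  let Y : ℕ → ProbabilityMeasure ℝ := fun n => ⟨levyLaw μ σ (η n), inferInstance⟩
  have hY : Tendsto Y atTop (𝓝 ⟨m, inferInstance⟩) := by
    refine ProbabilityMeasure.tendsto_of_tendsto_charFun fun θ => ?_
    change Tendsto (fun n => charFun (levyLaw μ σ (η n)) θ) atTop (𝓝 (charFun m θ))
    simp_rw [charFun_levyLaw, hm]
    refine (Complex.continuous_exp.tendsto _).comp (Tendsto.neg ?_)
    exact (hν.tendsto_setIntegral h0 (hν.integrable_exponent θ)).const_add _
  have hexp : ∀ n (l : ℝ), 0 ≤ l → Integrable (fun x => Real.exp (l * x)) (η n) := fun n l hl => by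
    refine Integrable.of_bound (C := 1) (by fun_prop)
      ((ae_restrict_mem measurableSet_Iic).mono fun x hx => ?_)
    have hx' : x ≤ 0 := le_trans (show x ≤ _ from hx) (neg_nonpos.2 (by positivity))
    rw [Real.norm_of_nonneg (Real.exp_pos _).le, Real.exp_le_one_iff]
    exact mul_nonpos_of_nonneg_of_nonpos hl hx'
  have hlim : ∀ l : ℝ, 0 ≤ l → Tendsto (fun n => Real.exp (levyLaplaceExponent μ σ (η n) l)) atTop
      (𝓝 (Real.exp (levyLaplaceExponent μ σ ν l))) := fun l hl =>
    (Real.continuous_exp.tendsto _).comp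
      ((hν.tendsto_setIntegral h0 (hν.integrable_laplace h0 hl)).const_add _)
  exact integrable_exp_of_tendsto (m := ⟨m, inferInstance⟩) hY
    (fun n => lintegral_exp_levyLaw μ σ (η n) l (hexp n l hl))
    (fun n => lintegral_exp_levyLaw μ σ (η n) (2 * l) (hexp n _ (by positivity)))
    (fun n => (Real.exp_pos _).le) (fun n => (Real.exp_pos _).le) (hlim l hl)
    (hlim (2 * l) (by positivity))

/-- The law of X_t has triplet (tμ, √t σ, tν), which reduces every time t to time 1. -/
theorem levyKhintchineExponent_scale (t : ℝ≥0) (μ σ : ℝ) (ν : Measure ℝ) (θ : ℝ) :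
    levyKhintchineExponent (t * μ) (√t * σ) (t • ν) θ = t * levyKhintchineExponent μ σ ν θ := by
  rw [levyKhintchineExponent, levyKhintchineExponent, integral_smul_nnreal_measure]
  have h : ((√t : ℝ) : ℂ) ^ 2 = ((t : ℝ) : ℂ) := by
    rw [← Complex.ofReal_pow, Real.sq_sqrt t.coe_nonneg]
  push_cast
  rw [mul_pow, h, NNReal.smul_def, Complex.real_smul]
  ring

theorem levyLaplaceExponent_scale (t : ℝ≥0) (μ σ : ℝ) (ν : Measure ℝ) (l : ℝ) :
    levyLaplaceExponent (t * μ) (√t * σ) (t • ν) l = t * levyLaplaceExponent μ σ ν l := by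
  rw [levyLaplaceExponent, levyLaplaceExponent, integral_smul_nnreal_measure]
  rw [mul_pow, Real.sq_sqrt t.coe_nonneg, NNReal.smul_def, smul_eq_mul]
  ring

theorem IsLevyMeasure.smul {ν : Measure ℝ} (hν : IsLevyMeasure ν) (t : ℝ≥0) :
    IsLevyMeasure (t • ν) := by
  refine ⟨by simp [hν.zero], ?_⟩
  have : ∫⁻ x, ENNReal.ofReal (min 1 (x ^ 2)) ∂(t • ν) =
      t * ∫⁻ x, ENNReal.ofReal (min 1 (x ^ 2)) ∂ν := by
    rw [← smul_eq_mul, ← lintegral_smul_measure]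
    rfl
  rw [this]
  exact ENNReal.mul_lt_top ENNReal.coe_lt_top hν.lintegral_lt_top

/-! ### The Laplace exponent of the process -/

section LevyProcess

variable {Ω : Type*} [MeasurableSpace Ω] {P : Measure Ω}
  {X : ℝ≥0 → Ω → ℝ} {μ σ : ℝ} {ν : Measure ℝ}

/-- Stationarity makes every increment nonpositive almost surely. This holds simultaneously on a
countable dense set of times and extends to all times by right-continuity. -/
theorem IsLevyProcess.ae_antitone (hX : IsLevyProcess X P) (h : ∀ t, ∀ᵐ ω ∂P, X t ω ≤ 0) :
    ∀ᵐ ω ∂P, Antitone fun t => X t ω := by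
  obtain ⟨D, hDc, hD⟩ := TopologicalSpace.exists_countable_dense ℝ≥0
  have hinc : ∀ d e : ℝ≥0, d ≤ e → ∀ᵐ ω ∂P, X e ω ≤ X d ω := by
    intro d e hde
    have h1 := (hX.stationary d (e - d)).symm.ae_snd (p := fun y => y ≤ 0) measurableSet_Iic
      (h (e - d))
    rw [add_tsub_cancel_of_le hde] at h1
    exact h1.mono fun ω hω => sub_nonpos.1 hω
  have hall : ∀ᵐ ω ∂P, ∀ d ∈ D, ∀ e ∈ D, d ≤ e → X e ω ≤ X d ω := by
    rw [ae_ball_iff hDc]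
    intro d _
    rw [ae_ball_iff hDc]
    intro e _
    by_cases hde : d ≤ e
    · exact (hinc d e hde).mono fun ω hω _ => hω
    · exact Eventually.of_forall fun ω h => absurd h hde
  filter_upwards [hall, hX.cadlag] with ω hω hc
  have hne : ∀ t : ℝ≥0, (𝓝[Ioi t ∩ D] t).NeBot := fun t => by
    rw [← mem_closure_iff_nhdsWithin_neBot]
    have h1 := closure_mono (hD.open_subset_closure_inter (isOpen_Ioi (a := t)))
    rw [closure_closure, closure_Ioi] at h1
    exact h1 self_mem_Ici
  have hlim : ∀ t : ℝ≥0, Tendsto (fun s => X s ω) (𝓝[Ioi t ∩ D] t) (𝓝 (X t ω)) := fun t =>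
    (hc t).1.mono (inter_subset_left.trans Ioi_subset_Ici_self)
  have step : ∀ (d : ℝ≥0) (_ : d ∈ D) (t : ℝ≥0), d < t → X t ω ≤ X d ω := fun d hd t hdt => by
    have := hne t
    refine le_of_tendsto (hlim t) ?_
    filter_upwards [self_mem_nhdsWithin] with e he
    exact hω d hd e he.2 (hdt.le.trans (le_of_lt he.1))
  intro s t hst
  rcases eq_or_lt_of_le hst with rfl | hst
  · exact le_rfl
  · have := hne s
    refine ge_of_tendsto (hlim s) ?_
    filter_upwards [self_mem_nhdsWithin, mem_nhdsWithin_of_mem_nhds (Iio_mem_nhds hst)] with d hd hdt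
    exact step d hd.2 t hdt

variable [IsProbabilityMeasure P]

theorem IsSpectrallyNegativeLevy.integral_exp (hX : IsSpectrallyNegativeLevy X P μ σ ν) (t : ℝ≥0)
    {l : ℝ} (hl : 0 ≤ l) :
    Integrable (fun ω => Real.exp (l * X t ω)) P ∧
      ∫ ω, Real.exp (l * X t ω) ∂P = Real.exp (t * levyLaplaceExponent μ σ ν l) := by
  have hm := hX.isLevy.measurable t
  have hp : IsProbabilityMeasure (P.map (X t)) := Measure.isProbabilityMeasure_map hm.aemeasurable
  have h := integral_exp_eq_of_charFun (hX.triplet.isLevyMeasure.smul t)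
    (by simp [hX.no_pos_jumps]) (t * μ) (√t * σ) (P.map (X t)) (fun θ => by
      rw [hX.triplet.charFun_eq t θ, levyKhintchineExponent_scale]; ring_nf) hl
  rw [levyLaplaceExponent_scale] at h
  obtain ⟨h1, h2⟩ := h
  rw [integrable_map_measure (by fun_prop) hm.aemeasurable] at h1
  rw [integral_map hm.aemeasurable (by fun_prop)] at h2
  exact ⟨h1, h2⟩

theorem IsSpectrallyNegativeLevy.laplaceExponent_eq (hX : IsSpectrallyNegativeLevy X P μ σ ν)
    {l : ℝ} (hl : 0 ≤ l) : laplaceExponent X P l = levyLaplaceExponent μ σ ν l := by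
  rw [laplaceExponent, cgf, mgf, (hX.integral_exp 1 hl).2, Real.log_exp, NNReal.coe_one, one_mul]

/-- If ψ ≤ C on (0, ∞), Chernoff's bound P(X_t ≥ ε) ≤ e^{-lε + tC} tends to 0 as l → ∞. Then X_t ≤ 0
almost surely for every t and the paths are decreasing, which is excluded. -/
theorem IsSpectrallyNegativeLevy.exists_lt_levyLaplaceExponent
    (hX : IsSpectrallyNegativeLevy X P μ σ ν) (C : ℝ) :
    ∃ l, 0 < l ∧ C < levyLaplaceExponent μ σ ν l := by
  by_contra! hcon
  refine hX.not_antitone (hX.isLevy.ae_antitone fun t => ?_)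
  have hε : ∀ n : ℕ, ∀ᵐ ω ∂P, X t ω < 1 / ((n : ℝ) + 1) := by
    intro n
    set ε : ℝ := 1 / ((n : ℝ) + 1) with hεdef
    have hεpos : 0 < ε := by positivity
    have hb : ∀ l : ℝ, 0 < l → P.real {ω | ε ≤ X t ω} ≤ Real.exp (-l * ε) * Real.exp (t * C) := by
      intro l hl
      obtain ⟨h1, h2⟩ := hX.integral_exp t hl.le
      refine (measure_ge_le_exp_mul_mgf ε hl.le h1).trans ?_
      rw [mgf, h2]
      gcongr
      exact hcon l hl
    have hlim : Tendsto (fun l : ℝ => Real.exp (-l * ε) * Real.exp (t * C)) atTop (𝓝 0) := by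
      have h1 : Tendsto (fun l : ℝ => -l * ε) atTop atBot := by
        simp_rw [neg_mul]
        exact tendsto_neg_atTop_atBot.comp (tendsto_id.atTop_mul_const hεpos)
      simpa using (Real.tendsto_exp_atBot.comp h1).mul_const (Real.exp (t * C))
    have h0 : P.real {ω | ε ≤ X t ω} ≤ 0 := by
      refine ge_of_tendsto hlim ?_
      filter_upwards [eventually_gt_atTop 0] with l hl using hb l hl
    have h0' : P {ω | ε ≤ X t ω} = 0 := (measureReal_eq_zero_iff).1 (le_antisymm h0 measureReal_nonneg)
    rw [ae_iff]
    simpa using h0'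
  filter_upwards [ae_all_iff.2 hε] with ω hω
  exact ge_of_tendsto' tendsto_one_div_add_atTop_nhds_zero_nat fun n => (hω n).le

end LevyProcess

/-! ### Stieltjes form of the Laplace exponent -/

namespace IsCompletelyMonotone

variable {f : ℝ → ℝ}

theorem hasDerivAt (hf : IsCompletelyMonotone f) (n : ℕ) {y : ℝ} (hy : 0 < y) :
    HasDerivAt (iteratedDeriv n f) (iteratedDeriv (n + 1) f y) y := by
  have h1 : DifferentiableOn ℝ (iteratedDerivWithin n f (Ioi 0)) (Ioi 0) :=
    hf.1.differentiableOn_iteratedDerivWithin (by exact_mod_cast WithTop.coe_lt_top _)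
      (uniqueDiffOn_Ioi 0)
  have h2 : EqOn (iteratedDeriv n f) (iteratedDerivWithin n f (Ioi 0)) (Ioi 0) :=
    fun x hx => (iteratedDerivWithin_of_isOpen isOpen_Ioi hx).symm
  have h3 : DifferentiableAt ℝ (iteratedDeriv n f) y :=
    (h1.congr h2).differentiableAt (Ioi_mem_nhds hy)
  rw [iteratedDeriv_succ]
  exact h3.hasDerivAt

theorem nonneg (hf : IsCompletelyMonotone f) {y : ℝ} (hy : 0 < y) : 0 ≤ f y := by
  simpa using hf.2 0 y hy

theorem antitoneOn (hf : IsCompletelyMonotone f) : AntitoneOn f (Ioi 0) := by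
  have hd : ∀ y, 0 < y → HasDerivAt f (iteratedDeriv 1 f y) y := fun y hy => by
    simpa using hf.hasDerivAt 0 hy
  refine antitoneOn_of_deriv_nonpos (convex_Ioi 0)
    (fun y hy => (hd y hy).continuousAt.continuousWithinAt) ?_ ?_ <;> rw [interior_Ioi]
  · exact fun y hy => (hd y hy).differentiableAt.differentiableWithinAt
  · intro y hy
    rw [(hd y hy).deriv]
    have := hf.2 1 y hy
    simp only [pow_one] at this
    linarith

theorem continuousOn (hf : IsCompletelyMonotone f) : ContinuousOn f (Ioi 0) := hf.1.continuousOn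

/-- Since f decreases, (y - 1) f(y) is at most the integral of f over (1, y]. -/
theorem tendsto_zero (hf : IsCompletelyMonotone f)
    (hfin : ∫⁻ y in Ioi 1, ENNReal.ofReal (f y) ≠ ∞) : Tendsto f atTop (𝓝 0) := by
  set C := (∫⁻ y in Ioi 1, ENNReal.ofReal (f y)).toReal with hC
  have hb : ∀ y, 1 < y → f y ≤ C / (y - 1) := by
    intro y hy
    rw [le_div_iff₀ (by linarith)]
    have h1 : ENNReal.ofReal (f y) * ENNReal.ofReal (y - 1) ≤ ∫⁻ y in Ioi 1, ENNReal.ofReal (f y) := by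
      rw [← Real.volume_Ioc, ← setLIntegral_const]
      refine (setLIntegral_mono' measurableSet_Ioc fun z hz => ?_).trans
        (lintegral_mono_set Ioc_subset_Ioi_self)
      have hz0 : (0 : ℝ) < z := by linarith [hz.1]
      exact ENNReal.ofReal_le_ofReal (hf.antitoneOn hz0 (show (0 : ℝ) < y by linarith) hz.2)
    rw [← ENNReal.ofReal_mul (hf.nonneg (by linarith))] at h1
    exact (ENNReal.ofReal_le_iff_le_toReal hfin).1 h1
  refine tendsto_of_tendsto_of_tendsto_of_le_of_le' tendsto_const_nhds
    (tendsto_const_nhds.div_atTop (tendsto_atTop_add_const_right _ (-1) tendsto_id) :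
      Tendsto (fun y : ℝ => C / (y + -1)) atTop (𝓝 0)) ?_ ?_
  · filter_upwards [eventually_gt_atTop 0] with y hy using hf.nonneg hy
  · filter_upwards [eventually_gt_atTop 1] with y hy using hb y hy

theorem completelyMonotoneFamily (hf : IsCompletelyMonotone f)
    (hfin : ∫⁻ y in Ioi 1, ENNReal.ofReal (f y) ≠ ∞) :
    CompletelyMonotoneFamily fun n y => (-1) ^ n * iteratedDeriv n f y where
  nonneg n y hy := hf.2 n y hy
  hasDerivAt n y hy := by
    have := (hf.hasDerivAt n hy).const_mul ((-1 : ℝ) ^ n)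
    rwa [show -((-1 : ℝ) ^ (n + 1) * iteratedDeriv (n + 1) f y) =
      (-1) ^ n * iteratedDeriv (n + 1) f y by ring]
  measurable n := by
    rw [iteratedDeriv_succ]
    exact (measurable_deriv _).const_mul _
  tendsto_zero := by simpa using hf.tendsto_zero hfin

end IsCompletelyMonotone

/-- The tails determine the measure on each half-line (-∞, -δ), where it is finite; these exhaust
(-∞, 0), which carries both measures. -/
theorem IsLevyMeasure.eq_map_withDensity {ν : Measure ℝ} (hν : IsLevyMeasure ν)
    (h0 : ν (Ioi 0) = 0) {f : ℝ → ℝ}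
    (htail : ∀ x : ℝ, 0 < x → ν (Iio (-x)) = ∫⁻ y in Ioi x, ENNReal.ofReal (f y)) :
    ν = ((volume.restrict (Ioi 0)).withDensity fun y => ENNReal.ofReal (f y)).map Neg.neg := by
  set ρ := ((volume.restrict (Ioi 0)).withDensity fun y => ENNReal.ofReal (f y)).map Neg.neg with hρ
  have hρtail : ∀ x : ℝ, 0 < x → ρ (Iio (-x)) = ν (Iio (-x)) := by
    intro x hx
    rw [hρ, Measure.map_apply measurable_neg measurableSet_Iio,
      withDensity_apply _ (measurable_neg measurableSet_Iio),
      Measure.restrict_restrict (measurable_neg measurableSet_Iio), htail x hx]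
    congr 2
    ext y
    simp only [mem_inter_iff, mem_preimage, mem_Iio, mem_Ioi, neg_lt_neg_iff]
    exact ⟨fun h => h.1, fun h => ⟨h, hx.trans h⟩⟩
  have hρneg : ∀ᵐ x ∂ρ, x < 0 := by
    rw [hρ, ae_map_iff measurable_neg.aemeasurable measurableSet_Iio]
    refine (withDensity_absolutelyContinuous _ _).ae_le ?_
    filter_upwards [ae_restrict_mem measurableSet_Ioi] with y hy
    simpa using hy
  have hU : (⋃ n : ℕ, Iio (-(1 / ((n : ℝ) + 1)))) = Iio 0 := by
    ext x
    simp only [mem_iUnion, mem_Iio]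
    constructor
    · rintro ⟨n, hn⟩
      exact hn.trans (neg_neg_iff_pos.2 (by positivity))
    · intro hx
      obtain ⟨n, hn⟩ := exists_nat_one_div_lt (neg_pos.2 hx)
      exact ⟨n, by linarith⟩
  have hrestrict : ∀ m : Measure ℝ, (∀ᵐ x ∂m, x < 0) →
      m.restrict (⋃ n : ℕ, Iio (-(1 / ((n : ℝ) + 1)))) = m := fun m hm => by
    rw [hU]
    exact Measure.restrict_eq_self_of_ae_mem hm
  rw [← hrestrict ν (hν.ae_neg h0), ← hrestrict ρ hρneg, Measure.restrict_iUnion_congr]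
  intro n
  have hδ : 0 < 1 / ((n : ℝ) + 1) := by positivity
  set δ := 1 / ((n : ℝ) + 1)
  have hfin : ν (Iio (-δ)) ≠ ∞ := by
    have := (hν.isFiniteMeasure_restrict hδ).measure_univ_lt_top
    rw [Measure.restrict_apply_univ] at this
    exact ne_top_of_le_ne_top this.ne (measure_mono Iio_subset_Iic_self)
  have hIio : ∀ a, ρ (Iio a ∩ Iio (-δ)) = ν (Iio a ∩ Iio (-δ)) := by
    intro a
    rw [Iio_inter_Iio]
    have hpos : 0 < -(a ⊓ -δ) := by
      have := min_le_right a (-δ)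
      linarith
    have := hρtail _ hpos
    rwa [neg_neg] at this
  have : IsFiniteMeasure (ν.restrict (Iio (-δ))) := ⟨by
    rw [Measure.restrict_apply_univ]; exact hfin.lt_top⟩
  refine ext_of_generate_finite _ (borel_eq_generateFrom_Iio ℝ ▸ BorelSpace.measurable_eq)
    isPiSystem_Iio ?_ ?_
  · rintro _ ⟨a, rfl⟩
    rw [Measure.restrict_apply measurableSet_Iio, Measure.restrict_apply measurableSet_Iio, hIio a]
  · rw [Measure.restrict_apply_univ, Measure.restrict_apply_univ, hρtail δ hδ]

/-- The compensator is linear in b, so it cancels in the divided difference of the integrand over b.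
-/
theorem laplaceKernel_neg_eq (x b : ℝ) (hb : b ≠ 0) : laplaceKernel (-x) b =
    ((Real.exp (b * x) - 1 - (if |x| < 1 then b * x else 0)) / b -
      (Real.exp (1 * x) - 1 - (if |x| < 1 then 1 * x else 0))) / (b - 1) := by
  rw [laplaceKernel, mul_neg, neg_neg, neg_neg, one_mul]
  congr 1
  split_ifs <;> field_simp <;> ring

/-- The Laplace exponent of a spectrally negative Lévy process whose Lévy measure has a completely
monotone density. -/
theorem IsLevyMeasure.exists_levyLaplaceExponent_eq {ν : Measure ℝ} (hν : IsLevyMeasure ν)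
    (h0 : ν (Ioi 0) = 0) (hcm : HasCompletelyMonotoneTailDensity ν) (μ σ : ℝ) :
    ∃ R, IsStieltjes R ∧ ∀ b, 0 < b → levyLaplaceExponent μ σ ν b =
      b * (levyLaplaceExponent μ σ ν 1 + (b - 1) * R b) := by
  obtain ⟨f, hf, htail⟩ := hcm
  have hfin1 : ∫⁻ y in Ioi 1, ENNReal.ofReal (f y) ≠ ∞ := by
    rw [← htail 1 one_pos]
    have := (hν.isFiniteMeasure_restrict one_pos).measure_univ_lt_top
    rw [Measure.restrict_apply_univ] at this
    exact ne_top_of_le_ne_top this.ne (measure_mono Iio_subset_Iic_self)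
  have hmap := hν.eq_map_withDensity h0 htail
  have hint : ∀ b, 0 < b → Integrable (fun x => laplaceKernel (-x) b) ν ∧
      ∫ x, laplaceKernel (-x) b ∂ν =
        ((∫ x, (Real.exp (b * x) - 1 - (if |x| < 1 then b * x else 0)) ∂ν) / b -
          ∫ x, (Real.exp (1 * x) - 1 - (if |x| < 1 then 1 * x else 0)) ∂ν) / (b - 1) := by
    intro b hb
    have i1 := (hν.integrable_laplace h0 hb.le).div_const b
    have i2 := hν.integrable_laplace h0 zero_le_one
    simp_rw [fun x => laplaceKernel_neg_eq x b hb.ne']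
    exact ⟨(i1.sub i2).div_const _, by rw [integral_div, integral_sub i1 i2, integral_div]⟩
  have hJ : ∀ b, 0 < b → ∫⁻ x in Ioi 0, ENNReal.ofReal (laplaceKernel x b) * ENNReal.ofReal (f x) =
      ENNReal.ofReal (∫ x, laplaceKernel (-x) b ∂ν) := by
    intro b hb
    rw [ofReal_integral_eq_lintegral_ofReal (hint b hb).1
      (Eventually.of_forall fun x => laplaceKernel_nonneg _ hb)]
    have hm : Measurable fun x => ENNReal.ofReal (laplaceKernel (-x) b) :=
      ((measurable_laplaceKernel b).comp measurable_neg).ennreal_ofReal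
    conv_rhs => rw [hmap]
    rw [lintegral_map hm measurable_neg, lintegral_withDensity_eq_lintegral_mul₀
      ((hf.continuousOn.aemeasurable measurableSet_Ioi).ennreal_ofReal)
      (g := fun x => ENNReal.ofReal (laplaceKernel (- -x) b))
      (hm.comp measurable_neg).aemeasurable]
    refine lintegral_congr fun x => ?_
    simp [mul_comm]
  obtain ⟨R, hR, hRv⟩ := (hf.completelyMonotoneFamily hfin1).exists_isStieltjes (fun b hb => by
    simp only [pow_zero, one_mul, iteratedDeriv_zero]
    rw [hJ b hb]
    exact ENNReal.ofReal_ne_top)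
  -- In (ψ(b)/b - ψ(1))/(b - 1) the drift cancels and the Gaussian part contributes the constant
  -- σ²/2. At b = 1 the identity is trivial, so the value of `R` there is immaterial.
  refine ⟨fun b => σ ^ 2 / 2 + R b, (IsStieltjes.const (by positivity)).add hR, fun b hb => ?_⟩
  by_cases hb1 : b = 1
  · simp [hb1]
  have hRb := hRv b hb hb1
  simp only [pow_zero, one_mul, iteratedDeriv_zero] at hRb
  rw [hJ b hb, ENNReal.toReal_ofReal (integral_nonneg fun x => laplaceKernel_nonneg _ hb),
    (hint b hb).2] at hRb
  have hb1' : b - 1 ≠ 0 := sub_ne_zero.2 hb1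
  simp only
  rw [hRb, levyLaplaceExponent, levyLaplaceExponent]
  field_simp
  ring

/-! ### Factorisation of ψ - q and its reciprocal -/

theorem exists_measure_integral_eq_cauchyKernel_mul (κ : Measure unitInterval) [IsFiniteMeasure κ]
    {c : ℝ} (hc : 0 < c) :
    ∃ m : Measure unitInterval, IsFiniteMeasure m ∧
      ∀ h : unitInterval → ℝ, ∫ u, h u ∂m = ∫ u, cauchyKernel c u * h u ∂κ := by
  have hi := (continuous_cauchyKernel hc).integrable_of_compactSpace κ
  refine ⟨κ.withDensity fun u => ENNReal.ofReal (cauchyKernel c u),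
    isFiniteMeasure_withDensity_ofReal hi.2, fun h => ?_⟩
  rw [integral_withDensity_eq_integral_toReal_smul
    (continuous_cauchyKernel hc).measurable.ennreal_ofReal
    (Eventually.of_forall fun u => ENNReal.ofReal_lt_top)]
  simp_rw [ENNReal.toReal_ofReal (cauchyKernel_pos hc _).le, smul_eq_mul]

/-- For the kernels K_b, K_c one has (b - 1) K_b - (c - 1) K_c = (b - c) K_b K_c, so S is
represented by the measure K_c κ. -/
theorem IsStieltjes.exists_sub_eq {R : ℝ → ℝ} (hR : IsStieltjes R) {c : ℝ} (hc : 0 < c) :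
    ∃ S, IsStieltjes S ∧ ∀ b, 0 < b → (b - 1) * R b - (c - 1) * R c = (b - c) * S b := by
  obtain ⟨κ, hκ, hR⟩ := hR
  obtain ⟨m, hm, hmi⟩ := exists_measure_integral_eq_cauchyKernel_mul κ hc
  refine ⟨fun b => ∫ u, _root_.cauchyKernel b u ∂m, ⟨m, hm, fun b _ => rfl⟩, fun b hb => ?_⟩
  simp only
  rw [hmi, hR b hb, hR c hc, ← integral_const_mul, ← integral_const_mul, ← integral_const_mul,
    ← integral_sub ((integrable_cauchyKernel hb κ).const_mul _)
      ((integrable_cauchyKernel hc κ).const_mul _)]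
  refine integral_congr_ae (Eventually.of_forall fun u => ?_)
  have h1 := (cauchyKernel_denom_pos hb u).ne'
  have h2 := (cauchyKernel_denom_pos hc u).ne'
  simp only [_root_.cauchyKernel]
  rw [← mul_inv, ← div_eq_mul_inv, ← div_eq_mul_inv, ← div_eq_mul_inv, div_sub_div _ _ h1 h2,
    div_eq_div_iff (mul_ne_zero h1 h2) (mul_ne_zero h2 h1)]
  ring

/-- Division of a Stieltjes function by a linear factor. -/
theorem IsStieltjes.exists_div_sub_eq {T : ℝ → ℝ} (hT : IsStieltjes T) {c : ℝ} (hc : 0 < c) :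
    ∃ m : Measure ℝ, IsFiniteMeasure m ∧ (∀ᵐ s ∂m, 0 ≤ s) ∧
      ∀ b, c < b → T b / (b - c) = T c / (b - c) - ∫ s, (b + s)⁻¹ ∂m := by
  obtain ⟨κ, hκ, hT⟩ := hT
  obtain ⟨m, hm, hmi⟩ := exists_measure_integral_eq_cauchyKernel_mul κ hc
  have hφm : Measurable fun u : unitInterval => (u : ℝ)⁻¹ - 1 := by fun_prop
  have hset : MeasurableSet (Ioi (0 : unitInterval)) := measurableSet_Ioi
  -- K_b = K_c - (b - c) u K_b K_c, and u K_b = 1/(b + s) for s = u⁻¹ - 1. The factor u kills the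
  -- atom at u = 0, hence the restriction.
  refine ⟨(m.restrict (Ioi 0)).map fun u : unitInterval => (u : ℝ)⁻¹ - 1, inferInstance, ?_, ?_⟩
  · rw [ae_map_iff hφm.aemeasurable measurableSet_Ici]
    filter_upwards [ae_restrict_mem hset] with u hu
    have hu0 : (0 : ℝ) < u := hu
    exact sub_nonneg.2 (one_le_inv_iff₀.2 ⟨hu0, u.2.2⟩)
  · intro b hcb
    have hb : 0 < b := hc.trans hcb
    have hbc : b - c ≠ 0 := (sub_pos.2 hcb).ne'
    have h1 : ∫ s, (b + s)⁻¹ ∂((m.restrict (Ioi 0)).map fun u : unitInterval => (u : ℝ)⁻¹ - 1) =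
        ∫ u, (u : ℝ) * _root_.cauchyKernel b u ∂m := by
      rw [integral_map hφm.aemeasurable (Measurable.aestronglyMeasurable (by fun_prop)),
        ← integral_indicator hset]
      refine integral_congr_ae (Eventually.of_forall fun u => ?_)
      by_cases hu : u ∈ Ioi (0 : unitInterval)
      · have hu0 : (u : ℝ) ≠ 0 := (show (0 : ℝ) < u from hu).ne'
        have h2 := (cauchyKernel_denom_pos hb u).ne'
        simp only [indicator_of_mem hu, _root_.cauchyKernel]
        rw [← div_eq_mul_inv, inv_eq_one_div, div_eq_div_iff _ h2]
        · field_simp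
          ring
        · have : b + ((u : ℝ)⁻¹ - 1) = (1 + (b - 1) * u) / u := by field_simp; ring
          rw [this]
          exact div_ne_zero h2 hu0
      · have hu0 : u = 0 := le_antisymm (not_lt.1 hu) u.2.1
        simp only [hu0]
        simp
    rw [h1, hmi, hT b hb, hT c hc, ← sub_eq_zero]
    have hcont : Continuous fun u : unitInterval =>
        _root_.cauchyKernel c u * ((u : ℝ) * _root_.cauchyKernel b u) :=
      (continuous_cauchyKernel hc).mul
        (continuous_subtype_val.mul (continuous_cauchyKernel hb))
    have hib := integrable_cauchyKernel hb κ
    have hic := integrable_cauchyKernel hc κ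
    have hi3 := hcont.integrable_of_compactSpace κ
    have hi4 : Integrable (fun u : unitInterval => _root_.cauchyKernel c u / (b - c) -
        _root_.cauchyKernel c u * ((u : ℝ) * _root_.cauchyKernel b u)) κ := (hic.div_const _).sub hi3
    rw [← integral_div, ← integral_div, ← integral_sub (hic.div_const _) hi3,
      ← integral_sub (hib.div_const _) hi4]
    refine integral_eq_zero_of_ae (Eventually.of_forall fun u => ?_)
    have h2 := (cauchyKernel_denom_pos hb u).ne'
    have h3 := (cauchyKernel_denom_pos hc u).ne'
    simp only [_root_.cauchyKernel, Pi.zero_apply]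
    generalize hx : 1 + (b - 1) * (u : ℝ) = x at *
    generalize hy : 1 + (c - 1) * (u : ℝ) = y at *
    field_simp
    linarith

/-- The reciprocal of `ψ - q`, where `ψ` is the Laplace exponent of a spectrally negative Lévy
process with completely monotone jump density. -/
theorem exists_inv_sub_eq {ψ R : ℝ → ℝ} (hR : IsStieltjes R) {p q Φ : ℝ}
    (hψ : ∀ b, 0 < b → ψ b = b * (p + (b - 1) * R b)) (hq : 0 ≤ q) (hΦ : 0 < Φ) (hΦq : ψ Φ = q)
    (hne : ∃ b, 0 < b ∧ ψ b ≠ q) :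
    (∀ b, 0 < b → ψ b = q → b = Φ) ∧
    ∃ A : ℝ, 0 < A ∧ ∃ m : Measure ℝ, IsFiniteMeasure m ∧ (∀ᵐ s ∂m, 0 ≤ s) ∧
      ∀ b, Φ < b → 1 / (ψ b - q) = A / (b - Φ) - ∫ s, (b + s)⁻¹ ∂m := by
  obtain ⟨S₀, hS₀, hS₀v⟩ := hR.exists_sub_eq hΦ
  -- Subtracting q/b = q/Φ - (b - Φ) q/(Φb) from ψ(b)/b = q/Φ + (b - Φ) S₀(b) produces this S; q ≥ 0
  -- keeps it Stieltjes.
  set S : ℝ → ℝ := fun b => S₀ b + q / Φ * (0 + b)⁻¹ with hSdef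
  have hS : IsStieltjes S := hS₀.add ((IsStieltjes.inv_add le_rfl).const_mul (div_nonneg hq hΦ.le))
  have hfac : ∀ b, 0 < b → ψ b - q = (b - Φ) * (b * S b) := by
    intro b hb
    have h1 := hS₀v b hb
    have h2 := hψ Φ hΦ
    rw [hΦq] at h2
    have h3 : p = q / Φ - (Φ - 1) * R Φ := by field_simp; linarith
    have hb' := hb.ne'
    rw [hψ b hb, h3, hSdef]
    simp only [zero_add]
    have h4 : q / Φ - (Φ - 1) * R Φ + (b - 1) * R b = q / Φ + (b - Φ) * S₀ b := by linarith
    rw [h4]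
    field_simp
    ring
  have hSpos : ∀ b, 0 < b → 0 < S b := by
    obtain ⟨b₀, hb₀, hne⟩ := hne
    refine fun b hb => hS.pos_of_pos hb₀ (fun h => hne ?_) hb
    have := hfac b₀ hb₀
    rw [h, mul_zero, mul_zero, sub_eq_zero] at this
    exact this
  refine ⟨fun b hb hbq => ?_, ?_⟩
  · have := hfac b hb
    rw [hbq, sub_self, zero_eq_mul] at this
    rcases this with h | h
    · linarith
    · exact absurd h (mul_pos hb (hSpos b hb)).ne'
  · have hT := hS.inv_mul (hSpos 1 one_pos).ne'
    obtain ⟨m, hm, hm0, hmv⟩ := hT.exists_div_sub_eq hΦ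
    refine ⟨(Φ * S Φ)⁻¹, inv_pos.2 (mul_pos hΦ (hSpos Φ hΦ)), m, hm, hm0, fun b hb => ?_⟩
    rw [← hmv b hb, hfac b (hΦ.trans hb), one_div, mul_inv, div_eq_mul_inv, mul_comm]

/-! ### Uniqueness of the Laplace transform -/

/-- Moments determine integrals of polynomials, which are uniformly dense by Weierstrass. -/
theorem measure_unitInterval_ext {M M' : Measure unitInterval} [IsFiniteMeasure M]
    [IsFiniteMeasure M'] (h : ∀ k : ℕ, ∫ v, (v : ℝ) ^ k ∂M = ∫ v, (v : ℝ) ^ k ∂M') : M = M' := by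
  have hpoly : ∀ p : Polynomial ℝ, ∫ v : unitInterval, p.eval (v : ℝ) ∂M =
      ∫ v : unitInterval, p.eval (v : ℝ) ∂M' := by
    intro p
    have hexp : ∀ N : Measure unitInterval, IsFiniteMeasure N →
        ∫ v : unitInterval, p.eval (v : ℝ) ∂N =
          ∑ i ∈ Finset.range (p.natDegree + 1), p.coeff i * ∫ v : unitInterval, (v : ℝ) ^ i ∂N := by
      intro N hN
      simp_rw [Polynomial.eval_eq_sum_range]
      rw [integral_finsetSum]
      · simp_rw [integral_const_mul]
      · intro i _
        exact Continuous.integrable_of_compactSpace (by fun_prop) N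
    rw [hexp M inferInstance, hexp M' inferInstance]
    simp_rw [h]
  refine ext_of_forall_integral_eq_of_IsFiniteMeasure fun f => ?_
  refine eq_of_forall_dist_le fun ε hε => ?_
  have hC : 0 < M.real univ + M'.real univ + 1 := by positivity
  obtain ⟨p, hp⟩ := exists_polynomial_near_continuousMap 0 1 f.toContinuousMap
    (ε / (M.real univ + M'.real univ + 1)) (by positivity)
  set δ := ε / (M.real univ + M'.real univ + 1) with hδ
  have hb : ∀ v : unitInterval, ‖f v - p.eval (v : ℝ)‖ ≤ δ := fun v => by
    rw [← norm_neg, neg_sub]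
    exact (ContinuousMap.norm_coe_le_norm
      (p.toContinuousMapOn (Icc 0 1) - f.toContinuousMap) v).trans hp.le
  have hdiff : ∀ N : Measure unitInterval, IsFiniteMeasure N →
      dist (∫ v, f v ∂N) (∫ v : unitInterval, p.eval (v : ℝ) ∂N) ≤ δ * N.real univ := by
    intro N hN
    rw [dist_eq_norm, ← integral_sub (f.integrable N)
      (Continuous.integrable_of_compactSpace (by fun_prop) N)]
    exact norm_integral_le_of_norm_le_const (Eventually.of_forall hb)
  have h1 := hdiff M inferInstance
  have h2 := hdiff M' inferInstance
  rw [← hpoly p, dist_comm] at h2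
  refine (dist_triangle _ _ _).trans ((add_le_add h1 h2).trans ?_)
  rw [← mul_add, hδ, div_mul_eq_mul_div, div_le_iff₀ hC]
  nlinarith

/-- Uniqueness of the Laplace transform, for nonnegative functions. -/
theorem ae_eq_of_laplace_eq {w w' : ℝ → ℝ} {c : ℝ} (hw : ∀ x, 0 < x → 0 ≤ w x)
    (hw' : ∀ x, 0 < x → 0 ≤ w' x)
    (hi : ∀ b, c < b → IntegrableOn (fun x => Real.exp (-b * x) * w x) (Ioi 0))
    (hi' : ∀ b, c < b → IntegrableOn (fun x => Real.exp (-b * x) * w' x) (Ioi 0))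
    (h : ∀ b, c < b → ∫ x in Ioi (0 : ℝ), Real.exp (-b * x) * w x =
      ∫ x in Ioi (0 : ℝ), Real.exp (-b * x) * w' x) :
    w =ᵐ[volume.restrict (Ioi 0)] w' := by
  -- The Laplace transform at b + k is the k-th moment of e^{-bx} w(x) dx transported to [0, 1] by x
  -- ↦ e^{-x}; the integers k suffice.
  let b := c + 1
  have hcb : c < b := by simp [b]
  let E : ℝ → unitInterval := fun x => ⟨Real.exp (-max 0 x), (Real.exp_pos _).le,
    Real.exp_le_one_iff.2 (neg_nonpos.2 (le_max_left _ _))⟩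
  have hE : Measurable E := Measurable.subtype_mk (by fun_prop)
  let M : (ℝ → ℝ) → Measure ℝ := fun w =>
    (volume.restrict (Ioi 0)).withDensity fun x => ENNReal.ofReal (Real.exp (-b * x) * w x)
  have hM : ∀ w : ℝ → ℝ, (∀ x, 0 < x → 0 ≤ w x) →
      (∀ b, c < b → IntegrableOn (fun x => Real.exp (-b * x) * w x) (Ioi 0)) →
      IsFiniteMeasure (M w) ∧ ∀ k : ℕ, ∫ v, (v : ℝ) ^ k ∂((M w).map E) =
        ∫ x in Ioi (0 : ℝ), Real.exp (-(b + k) * x) * w x := by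
    intro w hw hi
    refine ⟨isFiniteMeasure_withDensity_ofReal (hi b hcb).2, fun k => ?_⟩
    rw [integral_map hE.aemeasurable (Continuous.aestronglyMeasurable (by fun_prop)),
      integral_withDensity_eq_integral_toReal_smul₀ (hi b hcb).aemeasurable.ennreal_ofReal
        (Eventually.of_forall fun x => ENNReal.ofReal_lt_top)]
    refine setIntegral_congr_fun measurableSet_Ioi fun x hx => ?_
    have hx' : (0 : ℝ) < x := hx
    simp only [E]
    rw [ENNReal.toReal_ofReal (mul_nonneg (Real.exp_pos _).le (hw x hx')), max_eq_right hx'.le,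
      ← Real.exp_nat_mul, smul_eq_mul, mul_right_comm, ← Real.exp_add]
    ring_nf
  obtain ⟨hf, hk⟩ := hM w hw hi
  obtain ⟨hf', hk'⟩ := hM w' hw' hi'
  have hmap : (M w).map E = (M w').map E := by
    refine measure_unitInterval_ext fun k => ?_
    rw [hk, hk', h (b + k) (by have : (0 : ℝ) ≤ k := k.cast_nonneg; linarith)]
  have hinv : ∀ w, ((M w).map E).map (fun v : unitInterval => -Real.log v) = M w := by
    intro w
    rw [Measure.map_map (by fun_prop) hE]
    conv_rhs => rw [← Measure.map_id (μ := M w)]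
    refine Measure.map_congr ?_
    refine (withDensity_absolutelyContinuous _ _).ae_le ?_
    filter_upwards [ae_restrict_mem measurableSet_Ioi] with x hx
    simp [E, max_eq_right (le_of_lt (show (0 : ℝ) < x from hx))]
  have hMM : M w = M w' := by rw [← hinv w, hmap, hinv w']
  have hfin : ∫⁻ x in Ioi 0, ENNReal.ofReal (Real.exp (-b * x) * w x) ≠ ∞ := by
    have := hf.measure_univ_lt_top
    rw [withDensity_apply _ MeasurableSet.univ, Measure.restrict_univ] at this
    exact this.ne
  have hae := (withDensity_eq_iff (hi b hcb).aemeasurable.ennreal_ofReal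
    (hi' b hcb).aemeasurable.ennreal_ofReal hfin).1 hMM
  filter_upwards [hae, ae_restrict_mem measurableSet_Ioi] with x hx hx0
  have he := Real.exp_pos (-b * x)
  rw [ENNReal.ofReal_eq_ofReal_iff (mul_nonneg he.le (hw x hx0)) (mul_nonneg he.le (hw' x hx0))] at hx
  exact mul_left_cancel₀ he.ne' hx

/-- Functions continuous from the right that agree almost everywhere on `(0, ∞)` agree there. -/
theorem eqOn_Ioi_of_ae_eq {w w' : ℝ → ℝ} (h : w =ᵐ[volume.restrict (Ioi 0)] w')
    (hw : ∀ x, 0 < x → ContinuousWithinAt w (Ici x) x)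
    (hw' : ∀ x, 0 < x → ContinuousWithinAt w' (Ici x) x) : EqOn w w' (Ioi 0) := by
  intro x hx
  have hx' : (0 : ℝ) < x := hx
  have hfreq : ∃ᶠ y in 𝓝[>] x, w y = w' y := by
    rw [Filter.Frequently]
    intro hcon
    obtain ⟨z, hz, hsub⟩ := mem_nhdsGT_iff_exists_Ioo_subset.1 hcon
    have hz' : x < z := hz
    have h1 := (ae_iff.1 ((ae_restrict_iff' measurableSet_Ioi).1 h))
    have h2 : volume (Ioo x z) = 0 := measure_mono_null (fun y hy => by
      have := hsub hy
      simp only [mem_ofPred_eq, Classical.not_imp]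
      exact ⟨hx'.trans hy.1, this⟩) h1
    rw [Real.volume_Ioo, ENNReal.ofReal_eq_zero] at h2
    linarith
  have hlim : Tendsto (fun y => w y - w' y) (𝓝[>] x) (𝓝 (w x - w' x)) :=
    ((hw x hx').mono Ioi_subset_Ici_self).sub ((hw' x hx').mono Ioi_subset_Ici_self)
  by_contra hne
  have hev := hlim.eventually_ne (sub_ne_zero.2 hne)
  obtain ⟨y, hy1, hy2⟩ := (hfreq.and_eventually hev).exists
  exact hy2 (sub_eq_zero.2 hy1)

/-! ### The Laplace transform of m and the shape of W -/

section LaplaceOfMeasure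

variable {m : Measure ℝ} [IsFiniteMeasure m]

theorem integrable_exp_neg_mul (hm : ∀ᵐ s ∂m, 0 ≤ s) {x : ℝ} (hx : 0 ≤ x) :
    Integrable (fun s => Real.exp (x * -s)) m := by
  refine Integrable.of_bound (C := 1) (by fun_prop) (hm.mono fun s hs => ?_)
  rw [Real.norm_of_nonneg (Real.exp_pos _).le, Real.exp_le_one_iff, mul_neg, neg_nonpos]
  positivity

theorem mem_interior_integrableExpSet_neg (hm : ∀ᵐ s ∂m, 0 ≤ s) {x : ℝ} (hx : 0 < x) :
    x ∈ interior (integrableExpSet (fun s => -s) m) :=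
  mem_interior.2 ⟨Ioi 0, fun _ hy => integrable_exp_neg_mul hm (le_of_lt hy), isOpen_Ioi, hx⟩

theorem hasDerivAt_iteratedDeriv_mgf_neg (hm : ∀ᵐ s ∂m, 0 ≤ s) (n : ℕ) {x : ℝ} (hx : 0 < x) :
    HasDerivAt (iteratedDeriv n (mgf (fun s => -s) m))
      (iteratedDeriv (n + 1) (mgf (fun s => -s) m) x) x := by
  have h := mem_interior_integrableExpSet_neg hm hx
  rw [iteratedDeriv_mgf h]
  exact hasDerivAt_iteratedDeriv_mgf h n

theorem iteratedDeriv_three_mgf_neg_nonpos (hm : ∀ᵐ s ∂m, 0 ≤ s) {x : ℝ} (hx : 0 < x) :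
    iteratedDeriv 3 (mgf (fun s => -s) m) x ≤ 0 := by
  rw [iteratedDeriv_mgf (mem_interior_integrableExpSet_neg hm hx)]
  refine integral_nonpos_of_ae (hm.mono fun s hs => ?_)
  refine mul_nonpos_of_nonpos_of_nonneg ?_ (Real.exp_pos _).le
  have : 0 ≤ s ^ 3 := by positivity
  nlinarith

theorem continuousOn_mgf_neg (hm : ∀ᵐ s ∂m, 0 ≤ s) : ContinuousOn (mgf (fun s => -s) m) (Ioi 0) :=
  continuousOn_mgf.mono fun _ hx => mem_interior_integrableExpSet_neg hm hx

theorem integrableOn_integral_exp_mul_mgf_neg (hm : ∀ᵐ s ∂m, 0 ≤ s) {b : ℝ} (hb : 0 < b) :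
    IntegrableOn (fun x => Real.exp (-b * x) * mgf (fun s => -s) m x) (Ioi 0) ∧
      ∫ x in Ioi (0 : ℝ), Real.exp (-b * x) * mgf (fun s => -s) m x = ∫ s, (b + s)⁻¹ ∂m := by
  have hmeas : AEStronglyMeasurable (fun x => Real.exp (-b * x) * mgf (fun s => -s) m x)
      (volume.restrict (Ioi 0)) :=
    (ContinuousOn.mul (by fun_prop) (continuousOn_mgf_neg hm)).aestronglyMeasurable measurableSet_Ioi
  have hnn : 0 ≤ᵐ[volume.restrict (Ioi 0)] fun x => Real.exp (-b * x) * mgf (fun s => -s) m x :=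
    Eventually.of_forall fun x => mul_nonneg (Real.exp_pos _).le mgf_nonneg
  have hinv_nn : 0 ≤ᵐ[m] fun s => (b + s)⁻¹ := hm.mono fun s hs => inv_nonneg.2 (by positivity)
  have hinv : Integrable (fun s => (b + s)⁻¹) m := by
    refine Integrable.of_bound (C := b⁻¹) (Measurable.aestronglyMeasurable (by fun_prop))
      (hm.mono fun s hs => ?_)
    rw [Real.norm_of_nonneg (by positivity)]
    exact inv_anti₀ hb (by linarith)
  have key : ∫⁻ x in Ioi (0 : ℝ), ENNReal.ofReal (Real.exp (-b * x) * mgf (fun s => -s) m x) =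
      ENNReal.ofReal (∫ s, (b + s)⁻¹ ∂m) := by
    have h1 : ∫⁻ x in Ioi (0 : ℝ), ENNReal.ofReal (Real.exp (-b * x) * mgf (fun s => -s) m x) =
        ∫⁻ x in Ioi (0 : ℝ), ∫⁻ s, ENNReal.ofReal (Real.exp (-(b + s) * x)) ∂m := by
      refine setLIntegral_congr_fun measurableSet_Ioi fun x hx => ?_
      have hi := (integrable_exp_neg_mul hm (le_of_lt (show (0 : ℝ) < x from hx))).const_mul
        (Real.exp (-b * x))
      simp only [mgf]
      rw [← integral_const_mul, ofReal_integral_eq_lintegral_ofReal hi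
        (Eventually.of_forall fun s => by positivity)]
      refine lintegral_congr fun s => ?_
      rw [← Real.exp_add]
      ring_nf
    rw [h1, lintegral_lintegral_swap (by fun_prop),
      ofReal_integral_eq_lintegral_ofReal hinv hinv_nn]
    refine lintegral_congr_ae (hm.mono fun s hs => ?_)
    have hneg : -(b + s) < 0 := by linarith
    have h2 := integral_exp_mul_Ioi hneg 0
    simp only
    rw [← ofReal_integral_eq_lintegral_ofReal (integrableOn_exp_mul_Ioi hneg 0)
      (Eventually.of_forall fun x => (Real.exp_pos _).le), h2]
    congr 1
    rw [mul_zero, Real.exp_zero, neg_div_neg_eq, one_div]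
  refine ⟨⟨hmeas, ?_⟩, ?_⟩
  · rw [hasFiniteIntegral_iff_ofReal hnn, key]
    exact ENNReal.ofReal_lt_top
  · rw [integral_eq_lintegral_of_nonneg_ae hnn hmeas, key,
      ENNReal.toReal_ofReal (integral_nonneg_of_ae hinv_nn)]

end LaplaceOfMeasure

/-- The shape of `x ↦ A e^{Φx} - ∫ e^{-xs} m(ds)`. -/
theorem shape_of_eqOn {m : Measure ℝ} [IsFiniteMeasure m] (hm : ∀ᵐ s ∂m, 0 ≤ s) {A Φ : ℝ}
    (hA : 0 < A) (hΦ : 0 < Φ) {W : ℝ → ℝ}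
    (hW : EqOn W (fun x => A * Real.exp (Φ * x) - mgf (fun s => -s) m x) (Ioi 0)) :
    (∀ x, 0 < x → DifferentiableAt ℝ W x) ∧
      StrictConvexOn ℝ (Ioi 0) (deriv W) ∧
      ∃ a : ℝ, 0 ≤ a ∧ StrictConcaveOn ℝ (Ioo 0 a) W ∧ StrictConvexOn ℝ (Ioi a) W := by
  set V : ℕ → ℝ → ℝ := fun n x =>
    A * Φ ^ n * Real.exp (Φ * x) - iteratedDeriv n (mgf (fun s => -s) m) x with hV
  have hVd : ∀ n x, 0 < x → HasDerivAt (V n) (V (n + 1) x) x := by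
    intro n x hx
    have h1 : HasDerivAt (fun x => Real.exp (Φ * x)) (Real.exp (Φ * x) * (Φ * 1)) x :=
      ((hasDerivAt_id x).const_mul Φ).exp
    have h2 := (h1.const_mul (A * Φ ^ n)).sub (hasDerivAt_iteratedDeriv_mgf_neg hm n hx)
    have e : V (n + 1) x = A * Φ ^ n * (Real.exp (Φ * x) * (Φ * 1)) -
        iteratedDeriv (n + 1) (mgf (fun s => -s) m) x := by
      simp only [hV]; ring
    rw [e]
    exact h2
  have hd0 : ∀ x, 0 < x → HasDerivAt W (V 1 x) x := by
    intro x hx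
    refine (hVd 0 x hx).congr_of_eventuallyEq ?_
    filter_upwards [Ioi_mem_nhds hx] with y hy
    rw [hW hy]
    simp [hV]
  have hd1 : ∀ x, 0 < x → HasDerivAt (deriv W) (V 2 x) x := by
    intro x hx
    refine (hVd 1 x hx).congr_of_eventuallyEq ?_
    filter_upwards [Ioi_mem_nhds hx] with y hy using (hd0 y hy).deriv
  have hmono : StrictMonoOn (V 2) (Ioi 0) := by
    refine strictMonoOn_of_deriv_pos (convex_Ioi 0)
      (fun x hx => (hVd 2 x hx).continuousAt.continuousWithinAt) fun x hx => ?_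
    rw [interior_Ioi] at hx
    rw [(hVd 2 x hx).deriv]
    have h3 := iteratedDeriv_three_mgf_neg_nonpos hm hx
    have : 0 < A * Φ ^ 3 * Real.exp (Φ * x) := by positivity
    change 0 < A * Φ ^ 3 * Real.exp (Φ * x) - iteratedDeriv 3 (mgf (fun s => -s) m) x
    linarith
  have hanti : AntitoneOn (iteratedDeriv 2 (mgf (fun s => -s) m)) (Ioi 0) := by
    refine antitoneOn_of_deriv_nonpos (convex_Ioi 0) (fun x hx =>
      (hasDerivAt_iteratedDeriv_mgf_neg hm 2 hx).continuousAt.continuousWithinAt) ?_ ?_ <;>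
      rw [interior_Ioi] <;> intro x hx
    · exact (hasDerivAt_iteratedDeriv_mgf_neg hm 2 hx).differentiableAt.differentiableWithinAt
    · rw [(hasDerivAt_iteratedDeriv_mgf_neg hm 2 hx).deriv]
      exact iteratedDeriv_three_mgf_neg_nonpos hm hx
  refine ⟨fun x hx => (hd0 x hx).differentiableAt, ?_, ?_⟩
  · refine StrictMonoOn.strictConvexOn_of_deriv (convex_Ioi 0)
      (fun x hx => (hd1 x hx).continuousAt.continuousWithinAt) ?_
    rw [interior_Ioi]
    exact hmono.congr fun x hx => (hd1 x hx).deriv.symm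
  -- a* is the infimum of the points where W'' ≥ 0.
  · set N : Set ℝ := {x | 0 < x ∧ 0 ≤ V 2 x} with hN
    have hNne : N.Nonempty := by
      set c := iteratedDeriv 2 (mgf (fun s => -s) m) 1
      -- For x ≥ 1 the second derivative of the Laplace transform of m is at most its value c at 1,
      -- while AΦ² e^{Φx} ≥ AΦ³ x ≥ c.
      refine ⟨max 1 (c / (A * Φ ^ 3)), by positivity, ?_⟩
      set x := max 1 (c / (A * Φ ^ 3))
      have hx1 : 1 ≤ x := le_max_left _ _
      have hx0 : 0 < x := by linarith
      have h1 : iteratedDeriv 2 (mgf (fun s => -s) m) x ≤ c :=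
        hanti (show (0 : ℝ) < 1 from one_pos) hx0 hx1
      have h2 : c ≤ x * (A * Φ ^ 3) := (div_le_iff₀ (by positivity)).1 (le_max_right _ _)
      have h3 := Real.add_one_le_exp (Φ * x)
      have h4 : A * Φ ^ 2 * (Φ * x) ≤ A * Φ ^ 2 * Real.exp (Φ * x) := by
        gcongr
        linarith
      simp only [hV]
      nlinarith
    have hNb : BddBelow N := ⟨0, fun x hx => hx.1.le⟩
    have ha : 0 ≤ sInf N := Real.sInf_nonneg fun x hx => hx.1.le
    have hdd : ∀ x, 0 < x → deriv^[2] W x = V 2 x := fun x hx => (hd1 x hx).deriv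
    refine ⟨sInf N, ha, ?_, ?_⟩
    · refine strictConcaveOn_of_deriv2_neg (convex_Ioo _ _)
        (fun x hx => (hd0 x hx.1).continuousAt.continuousWithinAt) fun x hx => ?_
      rw [interior_Ioo] at hx
      rw [hdd x hx.1]
      by_contra hcon
      exact absurd (csInf_le hNb ⟨hx.1, not_lt.1 hcon⟩) (not_le.2 hx.2)
    · refine strictConvexOn_of_deriv2_pos (convex_Ioi _)
        (fun x hx => (hd0 x (ha.trans_lt hx)).continuousAt.continuousWithinAt) fun x hx => ?_
      rw [interior_Ioi] at hx
      have hx0 : 0 < x := ha.trans_lt hx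
      rw [hdd x hx0]
      obtain ⟨y, hy, hyx⟩ := exists_lt_of_csInf_lt hNne hx
      exact hy.2.trans_lt (hmono hy.1 hx0 hyx)

/-! ### Identification of the scale function -/

theorem mainTheorem9 {Ω : Type*} [MeasurableSpace Ω] (P : Measure Ω) [IsProbabilityMeasure P]
    (X : ℝ≥0 → Ω → ℝ) (μ σ : ℝ) (ν : Measure ℝ)
    (hX : IsSpectrallyNegativeLevy X P μ σ ν)
    (hν : HasCompletelyMonotoneTailDensity ν)
    (q : ℝ) (hq : 0 < q ∨ (q = 0 ∧ 0 < largestRoot (laplaceExponent X P) 0))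
    (W : ℝ → ℝ) (hW : IsScaleFunction (laplaceExponent X P) q W) :
    (∀ x, 0 < x → DifferentiableAt ℝ W x) ∧
      StrictConvexOn ℝ (Ioi 0) (deriv W) ∧
      ∃ a : ℝ, 0 ≤ a ∧ StrictConcaveOn ℝ (Ioo 0 a) W ∧ StrictConvexOn ℝ (Ioi a) W := by
  set ψ := laplaceExponent X P with hψdef
  obtain ⟨R, hR, hRψ⟩ := hX.triplet.isLevyMeasure.exists_levyLaplaceExponent_eq
    hX.no_pos_jumps hν μ σ
  have hψ : ∀ b, 0 < b → ψ b = b * (levyLaplaceExponent μ σ ν 1 + (b - 1) * R b) := fun b hb => by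
    rw [hψdef, hX.laplaceExponent_eq hb.le, hRψ b hb]
  have hbig : ∀ C, ∃ b, 0 < b ∧ C < ψ b := fun C => by
    obtain ⟨b, hb, hC⟩ := hX.exists_lt_levyLaplaceExponent C
    exact ⟨b, hb, by rw [hψdef, hX.laplaceExponent_eq hb.le]; exact hC⟩
  have hq0 : 0 ≤ q := by rcases hq with h | h; exacts [h.le, h.1.ge]
  have hroot : ∃ Φ, 0 < Φ ∧ ψ Φ = q := by
    rcases hq with hq | ⟨rfl, hq⟩
    · obtain ⟨b, hb, hbq⟩ := hbig q
      obtain ⟨κ, _, hκ⟩ := hR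
      set p := levyLaplaceExponent μ σ ν 1 with hp
      have hqp : 0 < q / (|p| + 1) := by positivity
      -- For ε ≤ 1 the term (ε - 1) R(ε) is nonpositive, so ψ(ε) ≤ ε (|p| + 1) ≤ q. As ψ(b) > q and
      -- ψ is continuous on [ε, b], there is a root by the intermediate value theorem.
      set ε := min (min 1 b) (q / (|p| + 1)) with hεdef
      have hε : 0 < ε := lt_min (lt_min one_pos hb) hqp
      have hε1 : ε ≤ 1 := (min_le_left _ _).trans (min_le_left _ _)
      have hεb : ε ≤ b := (min_le_left _ _).trans (min_le_right _ _)
      have hεq : ε * (|p| + 1) ≤ q := (le_div_iff₀ (by positivity)).1 (min_le_right _ _)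
      have hRε : 0 ≤ R ε := by
        rw [hκ ε hε]
        exact integral_nonneg fun u => (cauchyKernel_pos hε u).le
      have hψε : ψ ε ≤ q := by
        rw [hψ ε hε]
        have h1 : (ε - 1) * R ε ≤ 0 := mul_nonpos_of_nonpos_of_nonneg (by linarith) hRε
        refine le_trans (mul_le_mul_of_nonneg_left ?_ hε.le) hεq
        linarith [le_abs_self p]
      have hset : Ioi (0 : ℝ) ⊆ integrableExpSet (X 1) P := fun l hl => (hX.integral_exp 1 (le_of_lt hl)).1
      have hcont : ContinuousOn ψ (Icc ε b) := analyticOnNhd_cgf.continuousOn.mono fun l hl =>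
        interior_maximal hset isOpen_Ioi (hε.trans_le hl.1)
      obtain ⟨Φ, hΦ, hΦq⟩ := intermediate_value_Icc hεb hcont ⟨hψε, hbq.le⟩
      exact ⟨Φ, hε.trans_le hΦ.1, hΦq⟩
    · by_contra! hcon
      -- Without a positive root, the set defining Φ(0) has no positive element and its supremum
      -- cannot be positive.
      refine absurd hq (not_lt.2 (Real.sSup_nonpos fun l hl => ?_))
      by_contra hl0
      exact hcon l (not_le.1 hl0) hl.2
  obtain ⟨Φ, hΦ, hΦq⟩ := hroot
  obtain ⟨b₁, hb₁, hb₁q⟩ := hbig q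
  obtain ⟨huniq, A, hA, m, hm, hm0, hrep⟩ := exists_inv_sub_eq hR hψ hq0 hΦ hΦq
    ⟨b₁, hb₁, hb₁q.ne'⟩
  have hlargest : largestRoot ψ q = Φ := by
    refine IsGreatest.csSup_eq ⟨⟨hΦ.le, hΦq⟩, fun l hl => ?_⟩
    rcases eq_or_lt_of_le hl.1 with h | h
    · rw [← h]; exact hΦ.le
    · exact (huniq l h hl.2).le
  have hWi := hW.integrable
  have hWl := hW.laplace
  rw [hlargest] at hWi hWl
  refine shape_of_eqOn hm0 hA hΦ (W := W) ?_
  have hexp : ∀ b, Φ < b → IntegrableOn (fun x => Real.exp (-b * x) * (A * Real.exp (Φ * x))) (Ioi 0) ∧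
      ∫ x in Ioi (0 : ℝ), Real.exp (-b * x) * (A * Real.exp (Φ * x)) = A / (b - Φ) := by
    intro b hb
    have hneg : -(b - Φ) < 0 := by linarith
    have he : (fun x => Real.exp (-b * x) * (A * Real.exp (Φ * x))) =
        fun x => A * Real.exp (-(b - Φ) * x) := by
      funext x
      rw [mul_left_comm, ← Real.exp_add]
      ring_nf
    rw [he]
    refine ⟨(integrableOn_exp_mul_Ioi hneg 0).const_mul A, ?_⟩
    rw [integral_const_mul, integral_exp_mul_Ioi hneg, mul_zero, Real.exp_zero, neg_div_neg_eq,
      mul_one_div]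
  -- The Laplace transform of m is moved to the side of W so that both functions compared are
  -- nonnegative.
  have hsum : ∀ b, Φ < b →
      IntegrableOn (fun x => Real.exp (-b * x) * (W x + mgf (fun s => -s) m x)) (Ioi 0) ∧
      ∫ x in Ioi (0 : ℝ), Real.exp (-b * x) * (W x + mgf (fun s => -s) m x) = A / (b - Φ) := by
    intro b hb
    obtain ⟨h1, h2⟩ := integrableOn_integral_exp_mul_mgf_neg hm0 (hΦ.trans hb)
    simp_rw [mul_add]
    refine ⟨(hWi b hb).add h1, ?_⟩
    rw [integral_add (hWi b hb) h1, hWl b hb, h2, hrep b hb]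
    ring
  have hae : (fun x => W x + mgf (fun s => -s) m x) =ᵐ[volume.restrict (Ioi 0)]
      fun x => A * Real.exp (Φ * x) :=
    ae_eq_of_laplace_eq (fun x _ => add_nonneg (hW.nonneg x) mgf_nonneg)
      (fun x _ => by positivity) (fun b hb => (hsum b hb).1) (fun b hb => (hexp b hb).1)
      fun b hb => by rw [(hsum b hb).2, (hexp b hb).2]
  have heq := eqOn_Ioi_of_ae_eq hae (fun x hx => (hW.rightCont x hx.le).add
    ((continuousOn_mgf_neg hm0).continuousAt (Ioi_mem_nhds hx)).continuousWithinAt)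
    (fun x _ => Continuous.continuousWithinAt (by fun_prop))
  intro x hx
  have := heq hx
  simp only at this ⊢
  linarith
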